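/- **Conventions.** Let $C$ be a commutative ring, $K$ a commutative $C$-algebra and $\sigma$ an automorphism of the $C$-algebra $K$. Let $\mathcal D_{K,\sigma}=K\langle\sigma,\sigma^{-1}\rangle$ be the ring of finite sums $\sum_{i\in\mathbf Z}a_i\sigma^i$ ($a_i\in K$), with $\sigma^i a=\sigma^i(a)\sigma^i$. A *difference module* over $(K,\sigma)$ is a left $\mathcal D_{K,\sigma}$-module whose underlying $K$-module is finitely generated projective; equivalently, a pair $(E,\Phi)$ of a finitely generated projective $K$-module $E$ and an automorphism $\Phi$ of the additive group $E$ with $\Phi(\lambda x)=\sigma(\lambda)\Phi(x)$. A morphism $(E,\Phi)\to(F,\Psi)$ is a $K$-linear map $u$ with $\Psi u=u\Phi$. $\mathrm{Hom}$ is the set of morphisms, and $\mathrm{Ext}(M,N)=\mathrm{Ext}^1_{\mathcal D_{K,\sigma}}(M,N)$ is the $C$-module of classes of extensions of $M$ by $N$. For difference modules $P_1,\dots,P_k$ over $(K,\sigma)$, let $\mathcal F(P_1,\dots,P_k)$ be the set of equivalence classes of pairs $(\underline M,\underline u)$, where $\underline M=(0=M_0\subset M_1\subset\dots\subset M_k=M)$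 is a difference module filtered by difference submodules and $\underline u=(u_i:M_i/M_{i-1}\simeq P_i)_{1\le i\le k}$ are isomorphisms of difference modules. Two pairs $(\underline M,\underline u)$ and $(\underline M',\underline u')$ are equivalent if there is a morphism $f:M\to M'$ with $f(M_i)\subset M_i'$ and $u_i=u_i'\circ\mathrm{gr}_i f$ for all $i$ (such an $f$ is automatically an isomorphism). For a commutative $C$-algebra $C'$, put $K'=C'\otimes_C K$ and $\sigma'=1\otimes\sigma$; for a difference module $M=(E,\Phi)$ over $(K,\sigma)$, let $C'\otimes_C M=(K'\otimes_K E,\ \sigma'\otimes\Phi)$, a difference module over $(K',\sigma')$. Let $F(C')=\mathcal F(C'\otimes_C P_1,\dots,C'\otimes_C P_k)$, formed over $(K',\sigma')$. A morphism $C'\to C''$ of commutative $C$-algebras induces a map $F(C')\to F(C'')$ by extension of scalars, $(\underline M',\underline u')\mapsto(C''\otimes_{C'}\underline M',\,1\otimes\underline u')$. This makes $F$ a functor from commutative $C$-algebras to sets. **Theorem.** Let $P_1,\dots,P_k$ be difference modules over $(K,\sigma)$. Suppose that for all $1\le i<j\le k$ we have $\mathrm{Hom}(P_j,P_i)=0$,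 and that $\mathrm{Ext}(P_j,P_i)$ is a free $C$-module of finite rank $\delta_{i,j}$. Then the functor $F$ is represented by an affine space over $C$ of dimension $d=\sum_{1\le i<j\le k}\delta_{i,j}$; that is, there are bijections $\mathrm{Hom}_{C\text{-alg}}(C[T_1,\dots,T_d],C')\simeq F(C')$, natural in the commutative $C$-algebra $C'$. -/

import Mathlib

open CategoryTheory TensorProduct

universe u

noncomputable section

namespace DifferenceModules

/-! ### Difference algebras and difference modules -/

section Basic

variable {C K : Type u} [CommRing C] [CommRing K] [Algebra C K]

/-- A difference module over the difference `C`-algebra `(K, σ)`, in the description as a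
pair `(E, Φ)`: a finitely generated projective `K`-module `E` with a `σ`-linear
automorphism `Φ` of its additive group.  The corresponding left module over the ring of
difference operators is `DiffModule.toModuleCat` below. -/
structure DiffModule (σ : K ≃ₐ[C] K) where
  /-- The underlying `K`-module. -/
  carrier : Type u
  [addCommGroup : AddCommGroup carrier]
  [module : Module K carrier]
  [finite : Module.Finite K carrier]
  [projective : Module.Projective K carrier]
  /-- The `σ`-linear automorphism. -/
  Φ : carrier ≃+ carrier
  Φ_smul : ∀ (a : K) (x : carrier), Φ (a • x) = σ a • Φ x

instance (σ : K ≃ₐ[C] K) : CoeSort (DiffModule σ) (Type u) := ⟨DiffModule.carrier⟩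

attribute [instance] DiffModule.addCommGroup DiffModule.module DiffModule.finite
  DiffModule.projective

variable {σ : K ≃ₐ[C] K}

theorem DiffModule.Φ_symm_smul (M : DiffModule σ) (a : K) (x : M) :
    M.Φ.symm (a • x) = σ.symm a • M.Φ.symm x := by
  apply M.Φ.injective
  simp [M.Φ_smul]

/-- A morphism of difference modules: a `K`-linear map commuting with the
semilinear automorphisms. -/
structure DiffModule.Hom (M N : DiffModule σ) where
  /-- The underlying `K`-linear map. -/
  toLin : M →ₗ[K] N
  comm : ∀ x : M, toLin (M.Φ x) = N.Φ (toLin x)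

end Basic

/-! ### The Ore ring of difference operators, and `Ext` -/

section Ore

variable {C K : Type u} [CommRing C] [CommRing K] [Algebra C K]

/-- The action of `ℤ` on `K` through the powers of `σ`. -/
abbrev oreAction (σ : K ≃ₐ[C] K) : MulSemiringAction (Multiplicative ℤ) K :=
  MulSemiringAction.compHom K (zpowersHom (K ≃ₐ[C] K) σ)

/-- The ring `K⟨σ, σ⁻¹⟩` of difference operators: finite sums `∑ aᵢ σⁱ` with `i ∈ ℤ` and
`aᵢ ∈ K`, multiplied according to `σⁱ · a = σⁱ(a) σⁱ`. The monomial `a σⁱ` is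
`SkewMonoidAlgebra.single (Multiplicative.ofAdd i) a`. -/
def OreRing (_σ : K ≃ₐ[C] K) : Type u := SkewMonoidAlgebra K (Multiplicative ℤ)

instance (σ : K ≃ₐ[C] K) : Ring (OreRing σ) :=
  letI := oreAction σ
  (inferInstance : Ring (SkewMonoidAlgebra K (Multiplicative ℤ)))

theorem oreAction_smulCommClass (σ : K ≃ₐ[C] K) :
    letI := oreAction σ
    SMulCommClass (Multiplicative ℤ) C K :=
  letI := oreAction σ
  ⟨fun n c x => map_smul ((zpowersHom (K ≃ₐ[C] K) σ) n) c x⟩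

instance (σ : K ≃ₐ[C] K) : Algebra C (OreRing σ) :=
  letI := oreAction σ
  haveI := oreAction_smulCommClass σ
  (inferInstance : Algebra C (SkewMonoidAlgebra K (Multiplicative ℤ)))

variable {σ : K ≃ₐ[C] K}

/-- `Φ` as a unit of the ring of additive endomorphisms. -/
def DiffModule.unitΦ (M : DiffModule σ) : (AddMonoid.End M)ˣ where
  val := M.Φ.toAddMonoidHom
  inv := M.Φ.symm.toAddMonoidHom
  val_inv := AddMonoidHom.ext fun x => M.Φ.apply_symm_apply x
  inv_val := AddMonoidHom.ext fun x => M.Φ.symm_apply_apply x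

theorem DiffModule.unitΦ_zpow_smul (M : DiffModule σ) (n : ℤ) (a : K) (x : M) :
    ((M.unitΦ ^ n : (AddMonoid.End M)ˣ) : AddMonoid.End M) (a • x)
      = (σ ^ n) a • ((M.unitΦ ^ n : (AddMonoid.End M)ˣ) : AddMonoid.End M) x := by
  induction n with
  | zero => simp
  | succ n ih =>
    rw [add_comm, zpow_one_add, zpow_one_add, Units.val_mul, AddMonoid.End.coe_mul,
      Function.comp_apply, Function.comp_apply, ih]
    exact M.Φ_smul _ _
  | pred n ih =>
    rw [sub_eq_neg_add, zpow_add, zpow_add, zpow_neg_one, zpow_neg_one, Units.val_mul,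
      AddMonoid.End.coe_mul, Function.comp_apply, Function.comp_apply, ih]
    exact M.Φ_symm_smul _ _

/-- The action of the Ore ring on a difference module: `∑ aᵢ σⁱ` acts as `∑ aᵢ Φⁱ`. -/
def DiffModule.oreHom (M : DiffModule σ) : OreRing σ →+* AddMonoid.End M :=
  letI := oreAction σ
  SkewMonoidAlgebra.liftNCRingHom (Module.toAddMonoidEnd K M)
    ((Units.coeHom (AddMonoid.End M)).comp (zpowersHom _ M.unitΦ)) (by
      intro a n
      ext x
      exact (M.unitΦ_zpow_smul n.toAdd a x).symm)

/-- A difference module as a left module over the Ore ring. -/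
def DiffModule.toModuleCat (M : DiffModule σ) : ModuleCat.{u} (OreRing σ) :=
  letI : Module (OreRing σ) M := Module.compHom M M.oreHom
  ModuleCat.of (OreRing σ) M

end Ore

section Ore

variable {C K : Type u} [CommRing C] [CommRing K] [Algebra C K] {σ : K ≃ₐ[C] K}

/-- The `C`-module `Ext(M, N) = Ext¹(M, N)` of classes of extensions of `M` by `N`, computed
in the category of left modules over the ring of difference operators. -/
def DiffModule.Ext (M N : DiffModule σ) : Type u :=
  CategoryTheory.Abelian.Ext M.toModuleCat N.toModuleCat 1

instance (M N : DiffModule σ) : AddCommGroup (M.Ext N) :=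
  (inferInstance : AddCommGroup (CategoryTheory.Abelian.Ext M.toModuleCat N.toModuleCat 1))

open scoped ModuleCat.Algebra in
instance (M N : DiffModule σ) : Module C (M.Ext N) :=
  (inferInstance : Module C (CategoryTheory.Abelian.Ext M.toModuleCat N.toModuleCat 1))

end Ore

/-! ### Finitely filtered difference modules with prescribed graded module -/

section Filtered

variable {C K : Type u} [CommRing C] [CommRing K] [Algebra C K] {σ : K ≃ₐ[C] K} {k : ℕ}

/-- A pair `(M, u)`: a difference module `M` with a filtration
`0 = M₀ ⊆ M₁ ⊆ ⋯ ⊆ M_k = M` by difference submodules, and isomorphisms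
`uᵢ : Mᵢ / Mᵢ₋₁ ≃ Pᵢ`, the latter given by the induced epimorphisms `vᵢ : Mᵢ → Pᵢ` with kernel
`Mᵢ₋₁`. The index `i : Fin k` here stands for `i + 1` in the customary numbering.
(As the `Pᵢ` are finitely generated projective over `K`, so are all the `Mᵢ`.) -/
structure FilteredModule (P : Fin k → DiffModule σ) where
  /-- The total module. -/
  M : DiffModule σ
  /-- The steps of the filtration. -/
  fil : Fin (k + 1) → Submodule K M
  fil_zero : fil 0 = ⊥
  fil_last : fil (Fin.last k) = ⊤
  fil_le : ∀ i : Fin k, fil i.castSucc ≤ fil i.succ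
  Φ_mem : ∀ (i : Fin (k + 1)) (x : M), M.Φ x ∈ fil i ↔ x ∈ fil i
  /-- The epimorphisms onto the graded pieces. -/
  v : ∀ i : Fin k, fil i.succ →ₗ[K] P i
  v_Φ : ∀ (i : Fin k) (x : fil i.succ), v i ⟨M.Φ x, (Φ_mem _ _).2 x.2⟩ = (P i).Φ (v i x)
  v_surjective : ∀ i : Fin k, Function.Surjective (v i)
  v_eq_zero : ∀ (i : Fin k) (x : fil i.succ), v i x = 0 ↔ (x : M) ∈ fil i.castSucc

/-- `X` and `Y` are related if there is a morphism of difference modules that respects the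
filtrations and is compatible with the identifications of the graded modules with `P`.
Such a morphism is automatically an isomorphism, so this is an equivalence relation. -/
def FilteredModule.Equivalent {P : Fin k → DiffModule σ} (X Y : FilteredModule P) : Prop :=
  ∃ (f : X.M.Hom Y.M) (hf : ∀ (i : Fin (k + 1)) (x : X.M), x ∈ X.fil i → f.toLin x ∈ Y.fil i),
    ∀ (i : Fin k) (x : X.fil i.succ), Y.v i ⟨f.toLin x, hf _ _ x.2⟩ = X.v i x

/-- The set `𝓕(P₁, …, P_k)` of equivalence classes of pairs `(M, u)`. -/
def FilteredClasses (P : Fin k → DiffModule σ) : Type (u + 1) :=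
  Quot (FilteredModule.Equivalent (P := P))

/-- Transport of the identification of the graded module along isomorphisms `Pᵢ ≃ Qᵢ`. -/
def FilteredModule.mapGr {P Q : Fin k → DiffModule σ} (X : FilteredModule P)
    (e : ∀ i, P i ≃ₗ[K] Q i) (he : ∀ i x, e i ((P i).Φ x) = (Q i).Φ (e i x)) :
    FilteredModule Q where
  M := X.M
  fil := X.fil
  fil_zero := X.fil_zero
  fil_last := X.fil_last
  fil_le := X.fil_le
  Φ_mem := X.Φ_mem
  v i := (e i).toLinearMap ∘ₗ X.v i
  v_Φ i x := by simp [X.v_Φ, he]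
  v_surjective i := (e i).surjective.comp (X.v_surjective i)
  v_eq_zero i x := by simp [X.v_eq_zero]

/-- Every step of the filtration is a direct summand as a `K`-module. -/
theorem FilteredModule.exists_retraction {P : Fin k → DiffModule σ} (X : FilteredModule P)
    (i : Fin (k + 1)) : ∃ r : X.M →ₗ[K] X.fil i, ∀ x : X.fil i, r x = x := by
  induction i using Fin.reverseInduction with
  | last => exact ⟨LinearMap.id.codRestrict _ (fun x => X.fil_last ▸ Submodule.mem_top),
      fun x => rfl⟩
  | cast i ih =>
    obtain ⟨r, hr⟩ := ih
    obtain ⟨s, hs⟩ := Module.projective_lifting_property (X.v i) LinearMap.id (X.v_surjective i)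
    have hs' : ∀ y, X.v i (s y) = y := fun y => LinearMap.congr_fun hs y
    refine ⟨LinearMap.codRestrict _ ((X.fil i.succ).subtype ∘ₗ
      (LinearMap.id - s ∘ₗ X.v i) ∘ₗ r) (fun x => ?_), fun x => ?_⟩
    · exact (X.v_eq_zero i (r x - s (X.v i (r x)))).1 (by simp [hs'])
    · have h := hr ⟨x, X.fil_le i x.2⟩
      have h0 : X.v i ⟨x, X.fil_le i x.2⟩ = 0 := (X.v_eq_zero i _).2 x.2
      ext
      change ((r x - s (X.v i (r x)) : X.fil i.succ) : X.M) = x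
      have h' : r x = ⟨x, X.fil_le i x.2⟩ := h
      simp [h', h0]

end Filtered

/-! ### Extension of scalars -/

section BaseChange

variable {C K L : Type u} [CommRing C] [CommRing K] [Algebra C K] [CommRing L] [Algebra C L]
  [Algebra K L] {σ : K ≃ₐ[C] K} {k : ℕ}

/-- The additive map `τ ⊗ Φ` on `L ⊗[K] E`, for a `σ`-linear map `Φ` and a ring endomorphism
`τ` of `L` that extends `σ`. -/
def tensorΦ (s : K →+* K) (t : L →+* L) (h : ∀ a : K, t (algebraMap K L a) = algebraMap K L (s a))
    {E : Type u} [AddCommGroup E] [Module K E] (Φ : E →+ E) (hΦ : ∀ (a : K) x, Φ (a • x) = s a • Φ x) :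
    L ⊗[K] E →+ L ⊗[K] E :=
  (TensorProduct.map (σ₁₂ := s)
    ({ t with map_smul' := fun a x => by simp [Algebra.smul_def, h] } : L →ₛₗ[s] L)
    ({ Φ with map_smul' := hΦ } : E →ₛₗ[s] E)).toAddMonoidHom

theorem tensor_addHom_ext {E A : Type u} [AddCommGroup E] [Module K E] [AddCommGroup A]
    {f g : L ⊗[K] E →+ A} (h : ∀ l x, f (l ⊗ₜ x) = g (l ⊗ₜ x)) : f = g := by
  ext x
  induction x with
  | zero => simp
  | tmul l x => exact h l x
  | add x y hx hy => simp [hx, hy]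

/-- Extension of scalars along a morphism `(K, σ) → (L, τ)` of difference algebras:
`(E, Φ)` becomes `(L ⊗[K] E, τ ⊗ Φ)`. -/
def DiffModule.baseChange (M : DiffModule σ) (τ : L ≃ₐ[C] L)
    (h : ∀ a : K, τ (algebraMap K L a) = algebraMap K L (σ a)) : DiffModule τ where
  carrier := L ⊗[K] M
  Φ :=
    { toFun := tensorΦ (σ : K →+* K) (τ : L →+* L) h M.Φ.toAddMonoidHom M.Φ_smul
      invFun := tensorΦ (σ.symm : K →+* K) (τ.symm : L →+* L)
        (fun a => τ.injective (by simp [h])) M.Φ.symm.toAddMonoidHom M.Φ_symm_smul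
      left_inv := fun x => by
        induction x with
        | zero => simp
        | tmul l x =>
          change (τ.symm (τ l) ⊗ₜ[K] M.Φ.symm (M.Φ x) : L ⊗[K] M) = _
          simp
        | add x y hx hy => rw [map_add, map_add, hx, hy]
      right_inv := fun x => by
        induction x with
        | zero => simp
        | tmul l x =>
          change (τ (τ.symm l) ⊗ₜ[K] M.Φ (M.Φ.symm x) : L ⊗[K] M) = _
          simp
        | add x y hx hy => rw [map_add, map_add, hx, hy]
      map_add' := map_add _ }
  Φ_smul a x := by
    induction x with
    | zero => simp
    | tmul l x =>
      change (τ (a * l) ⊗ₜ[K] M.Φ x : L ⊗[K] M) = τ a • (τ l ⊗ₜ[K] M.Φ x)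
      simp [smul_tmul']
    | add x y hx hy => rw [smul_add, map_add, map_add, smul_add, hx, hy]

theorem DiffModule.baseChange_Φ_tmul (M : DiffModule σ) (τ : L ≃ₐ[C] L)
    (h : ∀ a : K, τ (algebraMap K L a) = algebraMap K L (σ a)) (l : L) (x : M) :
    (M.baseChange τ h).Φ (l ⊗ₜ[K] x : L ⊗[K] M) = (τ l ⊗ₜ[K] M.Φ x : L ⊗[K] M) := rfl

end BaseChange

section FilteredBaseChange

variable {C K : Type u} [CommRing C] [CommRing K] [Algebra C K] (L : Type u) [CommRing L]
  [Algebra K L] {σ : K ≃ₐ[C] K} {k : ℕ} {P : Fin k → DiffModule σ} (X : FilteredModule P)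

/-- For a filtered module, extension of scalars embeds every step of the filtration. -/
theorem FilteredModule.toBaseChange_bijective (i : Fin (k + 1)) :
    Function.Bijective ((X.fil i).toBaseChange L) := by
  refine ⟨?_, Submodule.toBaseChange_surjective _ _⟩
  obtain ⟨r, hr⟩ := X.exists_retraction i
  have h : Function.LeftInverse (fun y : (X.fil i).baseChange L => r.baseChange L y.1)
      ((X.fil i).toBaseChange L) := fun y => by
    induction y with
    | zero => simp
    | tmul l x => simp [hr]
    | add x y hx hy => simpa using congrArg₂ (· + ·) hx hy
  exact h.injective

/-- The isomorphism of `L ⊗[K] Mᵢ` onto the corresponding step of `L ⊗[K] M`. -/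
def FilteredModule.filEquiv (i : Fin (k + 1)) :
    L ⊗[K] X.fil i ≃ₗ[L] (X.fil i).baseChange L :=
  LinearEquiv.ofBijective _ (X.toBaseChange_bijective L i)

/-- The epimorphism `1 ⊗ vᵢ` on the step `L ⊗[K] Mᵢ` of `L ⊗[K] M`. -/
def FilteredModule.vBaseChange (i : Fin k) : (X.fil i.succ).baseChange L →ₗ[L] L ⊗[K] P i :=
  (X.v i).baseChange L ∘ₗ (X.filEquiv L i.succ).symm.toLinearMap

theorem FilteredModule.vBaseChange_tmul (i : Fin k) (l : L) (x : X.fil i.succ)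
    (hx : l ⊗ₜ[K] (x : X.M) ∈ (X.fil i.succ).baseChange L) :
    X.vBaseChange L i ⟨l ⊗ₜ[K] (x : X.M), hx⟩ = l ⊗ₜ[K] X.v i x := by
  have h : (X.filEquiv L i.succ).symm ⟨l ⊗ₜ[K] (x : X.M), hx⟩ = l ⊗ₜ[K] x :=
    (X.filEquiv L i.succ).symm_apply_eq.2 rfl
  simp [vBaseChange, h]

theorem FilteredModule.vBaseChange_surjective (i : Fin k) :
    Function.Surjective (X.vBaseChange L i) :=
  (LinearMap.lTensor_surjective L (X.v_surjective i)).comp (X.filEquiv L i.succ).symm.surjective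

theorem FilteredModule.vBaseChange_eq_zero (i : Fin k) (x : (X.fil i.succ).baseChange L) :
    X.vBaseChange L i x = 0 ↔ (x : L ⊗[K] X.M) ∈ (X.fil i.castSucc).baseChange L := by
  have hex : Function.Exact (Submodule.inclusion (X.fil_le i)) (X.v i) := fun y => by
    rw [X.v_eq_zero]
    exact ⟨fun hy => ⟨⟨y, hy⟩, rfl⟩, fun ⟨z, hz⟩ => hz ▸ z.2⟩
  have hT := lTensor_exact L hex (X.v_surjective i)
  have hc : ∀ w : L ⊗[K] X.fil i.castSucc,
      (X.filEquiv L i.succ ((Submodule.inclusion (X.fil_le i)).lTensor L w) : L ⊗[K] X.M)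
        = (X.fil i.castSucc).toBaseChange L w := fun w => by
    induction w with
    | zero => simp
    | tmul l x => rfl
    | add x y hx hy => simp only [map_add, Submodule.coe_add, hx, hy]
  obtain ⟨y, rfl⟩ := (X.filEquiv L i.succ).surjective x
  have hv : X.vBaseChange L i (X.filEquiv L i.succ y) = (X.v i).lTensor L y := by
    simp [vBaseChange]; rfl
  rw [hv, hT y]
  constructor
  · rintro ⟨w, rfl⟩
    rw [hc]
    exact Subtype.property _
  · intro hy
    obtain ⟨w, hw⟩ := Submodule.toBaseChange_surjective L (X.fil i.castSucc) ⟨_, hy⟩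
    refine ⟨w, (X.filEquiv L i.succ).injective (Subtype.ext ?_)⟩
    rw [hc, hw]

variable {L X} in
theorem FilteredModule.baseChange_induction
    {i : Fin (k + 1)} {p : (X.fil i).baseChange L → Prop} (zero : p 0)
    (tmul : ∀ (l : L) (x : X.fil i),
      p ⟨l ⊗ₜ[K] (x : X.M), Submodule.tmul_mem_baseChange_of_mem l x.2⟩)
    (add : ∀ x y, p x → p y → p (x + y)) (x : (X.fil i).baseChange L) : p x := by
  obtain ⟨y, rfl⟩ := Submodule.toBaseChange_surjective L (X.fil i) x
  induction y with
  | zero => simpa using zero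
  | tmul l x => exact tmul l x
  | add x y hx hy => rw [map_add]; exact add _ _ hx hy

theorem FilteredModule.baseChange_baseChange_induction {L' : Type u} [CommRing L'] [Algebra L L']
    (i : Fin (k + 1)) {p : ((X.fil i).baseChange L).baseChange L' → Prop} (zero : p 0)
    (tmul : ∀ (l : L') (a : L) (x : X.fil i),
      p ⟨l ⊗ₜ[L] (a ⊗ₜ[K] (x : X.M)), Submodule.tmul_mem_baseChange_of_mem l
        (Submodule.tmul_mem_baseChange_of_mem a x.2)⟩)
    (add : ∀ x y, p x → p y → p (x + y)) (x : ((X.fil i).baseChange L).baseChange L') : p x := by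
  obtain ⟨y, rfl⟩ := Submodule.toBaseChange_surjective L' ((X.fil i).baseChange L) x
  induction y with
  | zero => simpa using zero
  | tmul l x =>
    revert x
    refine baseChange_induction (L := L) ?_ (fun a x => ?_) fun x y hx hy => ?_
    · rw [tmul_zero, map_zero]
      exact zero
    · exact tmul l a x
    · rw [tmul_add, map_add]
      exact add _ _ hx hy
  | add x y hx hy => rw [map_add]; exact add _ _ hx hy

variable {L} [Algebra C L] (τ : L ≃ₐ[C] L)
  (h : ∀ a : K, τ (algebraMap K L a) = algebraMap K L (σ a))

theorem FilteredModule.baseChange_Φ_mem (i : Fin (k + 1)) (x : L ⊗[K] X.M) :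
    ((X.M.baseChange τ h).Φ x : L ⊗[K] X.M) ∈ (X.fil i).baseChange L
      ↔ x ∈ (X.fil i).baseChange L := by
  have h1 : ∀ y : (X.fil i).baseChange L,
      ((X.M.baseChange τ h).Φ y.1 : L ⊗[K] X.M) ∈ (X.fil i).baseChange L := by
    refine baseChange_induction ?_ (fun l x => ?_) fun x y hx hy => ?_
    · rw [Submodule.coe_zero]
      exact (map_zero (X.M.baseChange τ h).Φ).symm ▸ Submodule.zero_mem _
    · exact Submodule.tmul_mem_baseChange_of_mem _ ((X.Φ_mem i _).2 x.2)
    · rw [Submodule.coe_add]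
      exact (map_add (X.M.baseChange τ h).Φ x.1 y.1).symm ▸ Submodule.add_mem _ hx hy
  have h2 : ∀ y : (X.fil i).baseChange L,
      ((X.M.baseChange τ h).Φ.symm y.1 : L ⊗[K] X.M) ∈ (X.fil i).baseChange L := by
    refine baseChange_induction ?_ (fun l x => ?_) fun x y hx hy => ?_
    · rw [Submodule.coe_zero]
      exact (map_zero (X.M.baseChange τ h).Φ.symm).symm ▸ Submodule.zero_mem _
    · exact Submodule.tmul_mem_baseChange_of_mem _ ((X.Φ_mem i _).1 (by simp))
    · rw [Submodule.coe_add]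
      exact (map_add (X.M.baseChange τ h).Φ.symm x.1 y.1).symm ▸ Submodule.add_mem _ hx hy
  refine ⟨fun hx => ?_, fun hx => h1 ⟨x, hx⟩⟩
  have h3 := h2 ⟨_, hx⟩
  have h4 : (X.M.baseChange τ h).Φ.symm ((X.M.baseChange τ h).Φ x) = x :=
    AddEquiv.symm_apply_apply _ _
  exact h4 ▸ h3

theorem FilteredModule.vBaseChange_Φ (i : Fin k) (x : (X.fil i.succ).baseChange L) :
    X.vBaseChange L i ⟨(X.M.baseChange τ h).Φ x.1, (X.baseChange_Φ_mem τ h _ _).2 x.2⟩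
      = ((P i).baseChange τ h).Φ (X.vBaseChange L i x) := by
  revert x
  refine baseChange_induction ?_ (fun l x => ?_) fun x y hx hy => ?_
  · refine (congrArg (X.vBaseChange L i) (Subtype.ext ?_)).trans
      ((map_zero (X.vBaseChange L i)).trans ?_)
    · exact map_zero (X.M.baseChange τ h).Φ
    · rw [map_zero]
      exact (map_zero ((P i).baseChange τ h).Φ).symm
  · rw [X.vBaseChange_tmul L i l x]
    refine (X.vBaseChange_tmul L i (τ l) ⟨X.M.Φ x, (X.Φ_mem _ _).2 x.2⟩ _).trans ?_
    rw [X.v_Φ]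
    rfl
  · rw [map_add]
    refine Eq.trans ?_ ((congrArg₂ (· + ·) hx hy).trans (map_add ((P i).baseChange τ h).Φ _ _).symm)
    refine (congrArg (X.vBaseChange L i) (Subtype.ext ?_)).trans (map_add (X.vBaseChange L i) _ _)
    exact map_add (X.M.baseChange τ h).Φ _ _

/-- Extension of scalars of a filtered module along `(K, σ) → (L, τ)`: the filtration is formed
by the (images of the) `L ⊗[K] Mᵢ`, and the epimorphisms onto the graded pieces are the
`1 ⊗ vᵢ`. -/
def FilteredModule.baseChange : FilteredModule (fun i => (P i).baseChange τ h) where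
  M := X.M.baseChange τ h
  fil i := (X.fil i).baseChange L
  fil_zero := (congrArg (Submodule.baseChange L) X.fil_zero).trans (Submodule.baseChange_bot L)
  fil_last := (congrArg (Submodule.baseChange L) X.fil_last).trans (Submodule.baseChange_top L)
  fil_le i := Submodule.baseChange_mono _ (X.fil_le i)
  Φ_mem := X.baseChange_Φ_mem τ h
  v := X.vBaseChange L
  v_Φ := X.vBaseChange_Φ τ h
  v_surjective := X.vBaseChange_surjective L
  v_eq_zero := X.vBaseChange_eq_zero L

end FilteredBaseChange

/-! ### The functor on commutative algebras -/

section Tower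

variable {C K K₁ K₂ : Type u} [CommRing C] [CommRing K] [Algebra C K] [CommRing K₁] [Algebra C K₁]
  [CommRing K₂] [Algebra C K₂] [Algebra K K₁] [Algebra K K₂] [Algebra K₁ K₂] [IsScalarTower K K₁ K₂]
  {σ : K ≃ₐ[C] K} {k : ℕ} {P : Fin k → DiffModule σ}
  {σ₁ : K₁ ≃ₐ[C] K₁} {σ₂ : K₂ ≃ₐ[C] K₂}
  {h₁ : ∀ a : K, σ₁ (algebraMap K K₁ a) = algebraMap K K₁ (σ a)}

theorem DiffModule.cancelBaseChange_Φ (M : DiffModule σ)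
    (h₂ : ∀ a : K, σ₂ (algebraMap K K₂ a) = algebraMap K K₂ (σ a))
    (h₁₂ : ∀ a : K₁, σ₂ (algebraMap K₁ K₂ a) = algebraMap K₁ K₂ (σ₁ a))
    (x : K₂ ⊗[K₁] (K₁ ⊗[K] M)) :
    TensorProduct.AlgebraTensorModule.cancelBaseChange K K₁ K₂ K₂ M
        (((M.baseChange σ₁ h₁).baseChange σ₂ h₁₂).Φ x : K₂ ⊗[K₁] (K₁ ⊗[K] M))
      = (M.baseChange σ₂ h₂).Φ
        (TensorProduct.AlgebraTensorModule.cancelBaseChange K K₁ K₂ K₂ M x) := by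
  let c := TensorProduct.AlgebraTensorModule.cancelBaseChange K K₁ K₂ K₂ M
  let f : K₂ ⊗[K₁] (K₁ ⊗[K] M) →+ K₂ ⊗[K] M :=
    c.toAddEquiv.toAddMonoidHom.comp ((M.baseChange σ₁ h₁).baseChange σ₂ h₁₂).Φ.toAddMonoidHom
  let g : K₂ ⊗[K₁] (K₁ ⊗[K] M) →+ K₂ ⊗[K] M :=
    (M.baseChange σ₂ h₂).Φ.toAddMonoidHom.comp c.toAddEquiv.toAddMonoidHom
  suffices H : f = g from DFunLike.congr_fun H x
  refine tensor_addHom_ext fun l y => ?_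
  induction y with
  | zero => rw [tmul_zero, map_zero, map_zero]
  | tmul a y =>
    change (σ₁ a • σ₂ l) ⊗ₜ[K] M.Φ y = σ₂ (a • l) ⊗ₜ[K] M.Φ y
    rw [Algebra.smul_def, Algebra.smul_def, map_mul, h₁₂]
  | add y z hy hz => rw [tmul_add, map_add, map_add, hy, hz]

/-- Extension of scalars from `K₁` to `K₂` of a filtered module whose graded pieces are
`K₁ ⊗[K] Pᵢ`, the new graded pieces `K₂ ⊗[K₁] (K₁ ⊗[K] Pᵢ)` being identified with `K₂ ⊗[K] Pᵢ`. -/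
def FilteredModule.extend (X : FilteredModule (fun i => (P i).baseChange σ₁ h₁))
    (h₂ : ∀ a : K, σ₂ (algebraMap K K₂ a) = algebraMap K K₂ (σ a))
    (h₁₂ : ∀ a : K₁, σ₂ (algebraMap K₁ K₂ a) = algebraMap K₁ K₂ (σ₁ a)) :
    FilteredModule (fun i => (P i).baseChange σ₂ h₂) :=
  (X.baseChange σ₂ h₁₂).mapGr
    (fun i => TensorProduct.AlgebraTensorModule.cancelBaseChange K K₁ K₂ K₂ (P i))
    (fun i x => (P i).cancelBaseChange_Φ h₂ h₁₂ x)

/-- Extension of scalars respects equivalence of filtered modules. -/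
theorem FilteredModule.Equivalent.extend {X Y : FilteredModule (fun i => (P i).baseChange σ₁ h₁)}
    (hXY : X.Equivalent Y) (h₂ : ∀ a : K, σ₂ (algebraMap K K₂ a) = algebraMap K K₂ (σ a))
    (h₁₂ : ∀ a : K₁, σ₂ (algebraMap K₁ K₂ a) = algebraMap K₁ K₂ (σ₁ a)) :
    (X.extend h₂ h₁₂).Equivalent (Y.extend h₂ h₁₂) := by
  obtain ⟨f, hf, hv⟩ := hXY
  have hF : ∀ (i : Fin (k + 1)) (x : (X.fil i).baseChange K₂),
      f.toLin.baseChange K₂ x.1 ∈ (Y.fil i).baseChange K₂ := by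
    intro i
    refine baseChange_induction (L := K₂) ?_ (fun l x => ?_) fun x y hx hy => ?_
    · rw [Submodule.coe_zero, map_zero]
      exact Submodule.zero_mem _
    · exact Submodule.tmul_mem_baseChange_of_mem _ (hf i x x.2)
    · rw [Submodule.coe_add, map_add]
      exact Submodule.add_mem _ hx hy
  have hV : ∀ (i : Fin k) (x : (X.fil i.succ).baseChange K₂),
      Y.vBaseChange K₂ i ⟨f.toLin.baseChange K₂ x.1, hF _ x⟩ = X.vBaseChange K₂ i x := by
    intro i
    refine baseChange_induction (L := K₂) ?_ (fun l x => ?_) fun x y hx hy => ?_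
    · rw [map_zero]
      exact (congrArg (Y.vBaseChange K₂ i) (Subtype.ext (map_zero (f.toLin.baseChange K₂)))).trans
        (map_zero _)
    · rw [X.vBaseChange_tmul K₂ i l x]
      refine (Y.vBaseChange_tmul K₂ i l ⟨f.toLin x, hf _ _ x.2⟩ _).trans ?_
      rw [hv]
    · rw [map_add, ← hx, ← hy, ← map_add]
      exact congrArg (Y.vBaseChange K₂ i) (Subtype.ext (map_add (f.toLin.baseChange K₂) _ _))
  refine ⟨⟨f.toLin.baseChange K₂, fun x => ?_⟩, fun i x hx => hF i ⟨x, hx⟩, fun i x => ?_⟩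
  · let F : K₂ ⊗[K₁] X.M →+ K₂ ⊗[K₁] Y.M :=
      (f.toLin.baseChange K₂).toAddMonoidHom.comp (X.M.baseChange σ₂ h₁₂).Φ.toAddMonoidHom
    let G : K₂ ⊗[K₁] X.M →+ K₂ ⊗[K₁] Y.M :=
      (Y.M.baseChange σ₂ h₁₂).Φ.toAddMonoidHom.comp (f.toLin.baseChange K₂).toAddMonoidHom
    suffices H : F = G from DFunLike.congr_fun H x
    refine tensor_addHom_ext fun l y => ?_
    change σ₂ l ⊗ₜ[K₁] f.toLin (X.M.Φ y) = σ₂ l ⊗ₜ[K₁] Y.M.Φ (f.toLin y)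
    rw [f.comm]
  · exact congrArg (TensorProduct.AlgebraTensorModule.cancelBaseChange K K₁ K₂ K₂ (P i)) (hV i x)

variable {K₃ : Type u} [CommRing K₃] [Algebra C K₃] [Algebra K K₃] [Algebra K₁ K₃] [Algebra K₂ K₃]
  [IsScalarTower K K₁ K₃] [IsScalarTower K K₂ K₃] [IsScalarTower K₁ K₂ K₃] {σ₃ : K₃ ≃ₐ[C] K₃}

theorem cancelBaseChange_cancelBaseChange {E : Type u} [AddCommGroup E] [Module K E]
    (l : K₃) (a : K₂) (w : K₁ ⊗[K] E) :
    TensorProduct.AlgebraTensorModule.cancelBaseChange K K₁ K₃ K₃ E ((a • l) ⊗ₜ w)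
      = TensorProduct.AlgebraTensorModule.cancelBaseChange K K₂ K₃ K₃ E
        (l ⊗ₜ TensorProduct.AlgebraTensorModule.cancelBaseChange K K₁ K₂ K₂ E (a ⊗ₜ w)) := by
  induction w with
  | zero => simp
  | tmul b x => simp
  | add x y hx hy => simp only [tmul_add, map_add, hx, hy]

/-- Transitivity of extension of scalars. -/
theorem FilteredModule.extend_extend (X : FilteredModule (fun i => (P i).baseChange σ₁ h₁))
    (h₂ : ∀ a : K, σ₂ (algebraMap K K₂ a) = algebraMap K K₂ (σ a))
    (h₁₂ : ∀ a : K₁, σ₂ (algebraMap K₁ K₂ a) = algebraMap K₁ K₂ (σ₁ a))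
    (h₃ : ∀ a : K, σ₃ (algebraMap K K₃ a) = algebraMap K K₃ (σ a))
    (h₁₃ : ∀ a : K₁, σ₃ (algebraMap K₁ K₃ a) = algebraMap K₁ K₃ (σ₁ a))
    (h₂₃ : ∀ a : K₂, σ₃ (algebraMap K₂ K₃ a) = algebraMap K₂ K₃ (σ₂ a)) :
    ((X.extend h₂ h₁₂).extend h₃ h₂₃).Equivalent (X.extend h₃ h₁₃) := by
  let c := TensorProduct.AlgebraTensorModule.cancelBaseChange K₁ K₂ K₃ K₃ X.M
  have hF : ∀ (i : Fin (k + 1)) (x : ((X.fil i).baseChange K₂).baseChange K₃),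
      c x.1 ∈ (X.fil i).baseChange K₃ := by
    intro i
    refine X.baseChange_baseChange_induction K₂ i ?_ (fun l a x => ?_) fun x y hx hy => ?_
    · rw [Submodule.coe_zero, map_zero]
      exact Submodule.zero_mem _
    · exact Submodule.tmul_mem_baseChange_of_mem _ x.2
    · rw [Submodule.coe_add, map_add]
      exact Submodule.add_mem _ hx hy
  have hV : ∀ (i : Fin k) (x : ((X.fil i.succ).baseChange K₂).baseChange K₃),
      (X.extend h₃ h₁₃).v i ⟨c x.1, hF _ x⟩ = ((X.extend h₂ h₁₂).extend h₃ h₂₃).v i x := by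
    intro i
    refine X.baseChange_baseChange_induction K₂ i.succ ?_ (fun l a x => ?_) fun x y hx hy => ?_
    · exact (congrArg ((X.extend h₃ h₁₃).v i) (Subtype.ext (map_zero c))).trans
        ((map_zero ((X.extend h₃ h₁₃).v i)).trans
          (map_zero (((X.extend h₂ h₁₂).extend h₃ h₂₃).v i)).symm)
    · let c₂ := TensorProduct.AlgebraTensorModule.cancelBaseChange K K₁ K₂ K₂ (P i)
      let c₃ := TensorProduct.AlgebraTensorModule.cancelBaseChange K K₁ K₃ K₃ (P i)
      let c₂₃ := TensorProduct.AlgebraTensorModule.cancelBaseChange K K₂ K₃ K₃ (P i)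
      have e₁ : (X.extend h₃ h₁₃).v i ⟨(a • l) ⊗ₜ[K₁] (x : X.M),
          Submodule.tmul_mem_baseChange_of_mem _ x.2⟩ = c₃ ((a • l) ⊗ₜ X.v i x) :=
        congrArg c₃ (X.vBaseChange_tmul K₃ i (a • l) x _)
      have e₂ : (X.extend h₂ h₁₂).v i ⟨a ⊗ₜ[K₁] (x : X.M),
          Submodule.tmul_mem_baseChange_of_mem _ x.2⟩ = c₂ (a ⊗ₜ X.v i x) :=
        congrArg c₂ (X.vBaseChange_tmul K₂ i a x _)
      have e₃ : ((X.extend h₂ h₁₂).extend h₃ h₂₃).v i ⟨l ⊗ₜ[K₂] (a ⊗ₜ[K₁] (x : X.M)),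
          Submodule.tmul_mem_baseChange_of_mem _
            (Submodule.tmul_mem_baseChange_of_mem _ x.2)⟩ = c₂₃ (l ⊗ₜ c₂ (a ⊗ₜ X.v i x)) :=
        (congrArg c₂₃ ((X.extend h₂ h₁₂).vBaseChange_tmul K₃ i l
          ⟨a ⊗ₜ[K₁] (x : X.M), Submodule.tmul_mem_baseChange_of_mem _ x.2⟩ _)).trans
          (congrArg (fun z => c₂₃ (l ⊗ₜ z)) e₂)
      refine e₁.trans (Eq.trans ?_ e₃.symm)
      exact cancelBaseChange_cancelBaseChange l a _
    · exact (congrArg ((X.extend h₃ h₁₃).v i) (Subtype.ext (map_add c _ _))).trans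
        ((map_add ((X.extend h₃ h₁₃).v i) ⟨c x.1, hF _ x⟩ ⟨c y.1, hF _ y⟩).trans
          ((congrArg₂ (· + ·) hx hy).trans
            (map_add (((X.extend h₂ h₁₂).extend h₃ h₂₃).v i) _ _).symm))
  exact ⟨⟨c.toLinearMap, X.M.cancelBaseChange_Φ h₁₃ h₂₃⟩, fun i x hx => hF i ⟨x, hx⟩, hV⟩

theorem cancelBaseChange_self_tmul {E : Type u} [AddCommGroup E] [Module K E]
    (l : K₁) (w : K₁ ⊗[K] E) :
    l • w = TensorProduct.AlgebraTensorModule.cancelBaseChange K K₁ K₁ K₁ E (l ⊗ₜ w) := by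
  induction w with
  | zero => simp
  | tmul b x => simp [smul_tmul', mul_comm]
  | add x y hx hy => simp only [smul_add, tmul_add, map_add, hx, hy]

/-- Extension of scalars along the identity. -/
theorem FilteredModule.extend_self (X : FilteredModule (fun i => (P i).baseChange σ₁ h₁)) :
    (X.extend (K₂ := K₁) h₁ (fun _ => rfl)).Equivalent X := by
  let c := TensorProduct.lid K₁ X.M
  have hF : ∀ (i : Fin (k + 1)) (x : (X.fil i).baseChange K₁), c x.1 ∈ X.fil i := by
    intro i
    refine baseChange_induction (L := K₁) ?_ (fun l x => ?_) fun x y hx hy => ?_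
    · rw [Submodule.coe_zero, map_zero]
      exact Submodule.zero_mem _
    · exact Submodule.smul_mem _ _ x.2
    · rw [Submodule.coe_add, map_add]
      exact Submodule.add_mem _ hx hy
  have hV : ∀ (i : Fin k) (x : (X.fil i.succ).baseChange K₁),
      X.v i ⟨c x.1, hF _ x⟩ = (X.extend (K₂ := K₁) h₁ (fun _ => rfl)).v i x := by
    intro i
    refine baseChange_induction (L := K₁) ?_ (fun l x => ?_) fun x y hx hy => ?_
    · exact (congrArg (X.v i) (Subtype.ext (map_zero c))).trans
        ((map_zero (X.v i)).trans
          (map_zero ((X.extend (K₂ := K₁) h₁ (fun _ => rfl)).v i)).symm)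
    · let c' := TensorProduct.AlgebraTensorModule.cancelBaseChange K K₁ K₁ K₁ (P i)
      refine Eq.trans ?_ (congrArg c' (X.vBaseChange_tmul K₁ i l x _)).symm
      refine (map_smul (X.v i) l x).trans ?_
      exact cancelBaseChange_self_tmul l _
    · exact (congrArg (X.v i) (Subtype.ext (map_add c _ _))).trans
        ((map_add (X.v i) ⟨c x.1, hF _ x⟩ ⟨c y.1, hF _ y⟩).trans
          ((congrArg₂ (· + ·) hx hy).trans
            (map_add ((X.extend (K₂ := K₁) h₁ (fun _ => rfl)).v i) _ _).symm))
  refine ⟨⟨c.toLinearMap, fun x => ?_⟩, fun i x hx => hF i ⟨x, hx⟩, hV⟩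
  let F : K₁ ⊗[K₁] X.M →+ X.M :=
    c.toAddEquiv.toAddMonoidHom.comp (X.M.baseChange σ₁ fun _ => rfl).Φ.toAddMonoidHom
  let G : K₁ ⊗[K₁] X.M →+ X.M := X.M.Φ.toAddMonoidHom.comp c.toAddEquiv.toAddMonoidHom
  suffices H : F = G from DFunLike.congr_fun H x
  refine tensor_addHom_ext fun l y => ?_
  exact (X.M.Φ_smul l y).symm

end Tower

section ExtendHom

variable {C K K₁ K₂ : Type u} [CommRing C] [CommRing K] [Algebra C K] [CommRing K₁] [Algebra C K₁]
  [CommRing K₂] [Algebra C K₂] [Algebra K K₁] [Algebra K K₂]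
  {σ : K ≃ₐ[C] K} {k : ℕ} {P : Fin k → DiffModule σ}
  {σ₁ : K₁ ≃ₐ[C] K₁} {σ₂ : K₂ ≃ₐ[C] K₂}
  {h₁ : ∀ a : K, σ₁ (algebraMap K K₁ a) = algebraMap K K₁ (σ a)}

/-- `FilteredModule.extend` for the `K₁`-algebra structure on `K₂` given by a morphism `f`. -/
def FilteredModule.extendHom (f : K₁ →ₐ[K] K₂)
    (X : FilteredModule (fun i => (P i).baseChange σ₁ h₁))
    (h₂ : ∀ a : K, σ₂ (algebraMap K K₂ a) = algebraMap K K₂ (σ a))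
    (hf : ∀ a : K₁, σ₂ (f a) = f (σ₁ a)) :
    FilteredModule (fun i => (P i).baseChange σ₂ h₂) :=
  letI : Algebra K₁ K₂ := f.toRingHom.toAlgebra
  haveI : IsScalarTower K K₁ K₂ := IsScalarTower.of_algebraMap_eq fun a => (f.commutes a).symm
  X.extend h₂ hf

theorem FilteredModule.Equivalent.extendHom (f : K₁ →ₐ[K] K₂)
    {X Y : FilteredModule (fun i => (P i).baseChange σ₁ h₁)} (hXY : X.Equivalent Y)
    (h₂ : ∀ a : K, σ₂ (algebraMap K K₂ a) = algebraMap K K₂ (σ a))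
    (hf : ∀ a : K₁, σ₂ (f a) = f (σ₁ a)) :
    (X.extendHom f h₂ hf).Equivalent (Y.extendHom f h₂ hf) :=
  letI : Algebra K₁ K₂ := f.toRingHom.toAlgebra
  haveI : IsScalarTower K K₁ K₂ := IsScalarTower.of_algebraMap_eq fun a => (f.commutes a).symm
  hXY.extend h₂ hf

theorem FilteredModule.extendHom_id (f : K₁ →ₐ[K] K₁) (hf : f = AlgHom.id K K₁)
    (X : FilteredModule (fun i => (P i).baseChange σ₁ h₁))
    (h : ∀ a : K₁, σ₁ (f a) = f (σ₁ a)) : (X.extendHom f h₁ h).Equivalent X := by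
  subst hf
  exact X.extend_self

theorem FilteredModule.extendHom_comp {K₃ : Type u} [CommRing K₃] [Algebra C K₃] [Algebra K K₃]
    {σ₃ : K₃ ≃ₐ[C] K₃} (f : K₁ →ₐ[K] K₂) (g : K₂ →ₐ[K] K₃) (e : K₁ →ₐ[K] K₃) (he : e = g.comp f)
    (X : FilteredModule (fun i => (P i).baseChange σ₁ h₁))
    (h₂ : ∀ a : K, σ₂ (algebraMap K K₂ a) = algebraMap K K₂ (σ a))
    (hf : ∀ a : K₁, σ₂ (f a) = f (σ₁ a))
    (h₃ : ∀ a : K, σ₃ (algebraMap K K₃ a) = algebraMap K K₃ (σ a))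
    (h : ∀ a : K₁, σ₃ (e a) = e (σ₁ a)) (hg : ∀ a : K₂, σ₃ (g a) = g (σ₂ a)) :
    ((X.extendHom f h₂ hf).extendHom g h₃ hg).Equivalent (X.extendHom e h₃ h) := by
  subst he
  let _ : Algebra K₁ K₂ := f.toRingHom.toAlgebra
  let _ : Algebra K₂ K₃ := g.toRingHom.toAlgebra
  let _ : Algebra K₁ K₃ := (g.comp f).toRingHom.toAlgebra
  have : IsScalarTower K K₁ K₂ := IsScalarTower.of_algebraMap_eq fun a => (f.commutes a).symm
  have : IsScalarTower K K₂ K₃ := IsScalarTower.of_algebraMap_eq fun a => (g.commutes a).symm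
  have : IsScalarTower K K₁ K₃ :=
    IsScalarTower.of_algebraMap_eq fun a => ((g.comp f).commutes a).symm
  have : IsScalarTower K₁ K₂ K₃ := IsScalarTower.of_algebraMap_eq fun a => rfl
  exact X.extend_extend h₂ hf h₃ h hg

end ExtendHom

section Functor

variable {C K : Type u} [CommRing C] [CommRing K] [Algebra C K] (σ : K ≃ₐ[C] K) {k : ℕ}

/-- The automorphism `σ ⊗ 1` of `K ⊗[C] C'`. -/
abbrev extendAut (C' : Type u) [CommRing C'] [Algebra C C'] : K ⊗[C] C' ≃ₐ[C] K ⊗[C] C' :=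
  Algebra.TensorProduct.congr σ AlgEquiv.refl

theorem extendAut_map {C' C'' : Type u} [CommRing C'] [Algebra C C'] [CommRing C''] [Algebra C C'']
    (φ : C' →ₐ[C] C'') (a : K ⊗[C] C') :
    extendAut σ C'' (Algebra.TensorProduct.map (AlgHom.id K K) φ a)
      = Algebra.TensorProduct.map (AlgHom.id K K) φ (extendAut σ C' a) := by
  induction a with
  | zero => simp
  | tmul x y => simp
  | add x y hx hy => simp only [map_add, hx, hy]

variable {σ}

/-- The difference module over `(K ⊗[C] C', σ ⊗ 1)` obtained from `M` by extension of scalars. -/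
abbrev DiffModule.extendScalars (M : DiffModule σ) (C' : Type u) [CommRing C'] [Algebra C C'] :
    DiffModule (extendAut σ C') :=
  M.baseChange (extendAut σ C') (fun a => by
    simp [extendAut, Algebra.TensorProduct.algebraMap_apply])

/-- The map `𝓕(C' ⊗ P₁, …, C' ⊗ P_k) → 𝓕(C'' ⊗ P₁, …, C'' ⊗ P_k)` induced by a morphism
`C' → C''` of commutative `C`-algebras. -/
def FilteredClasses.extend (P : Fin k → DiffModule σ) {C' C'' : Type u} [CommRing C'] [Algebra C C']
    [CommRing C''] [Algebra C C''] (φ : C' →ₐ[C] C'') :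
    FilteredClasses (fun i => (P i).extendScalars C') →
      FilteredClasses (fun i => (P i).extendScalars C'') :=
  Quot.map
    (fun X => X.extendHom (Algebra.TensorProduct.map (AlgHom.id K K) φ) _ (extendAut_map σ φ))
    (fun _ _ hXY => hXY.extendHom _ _ _)

theorem FilteredClasses.extend_id (P : Fin k → DiffModule σ) (C' : Type u) [CommRing C']
    [Algebra C C'] (x : FilteredClasses (fun i => (P i).extendScalars C')) :
    FilteredClasses.extend P (AlgHom.id C C') x = x := by
  obtain ⟨X, rfl⟩ := Quot.exists_rep x
  exact Quot.sound (X.extendHom_id _ Algebra.TensorProduct.map_id _)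

theorem FilteredClasses.extend_comp (P : Fin k → DiffModule σ) {C₁ C₂ C₃ : Type u} [CommRing C₁]
    [Algebra C C₁] [CommRing C₂] [Algebra C C₂] [CommRing C₃] [Algebra C C₃]
    (φ : C₁ →ₐ[C] C₂) (ψ : C₂ →ₐ[C] C₃) (x : FilteredClasses (fun i => (P i).extendScalars C₁)) :
    FilteredClasses.extend P (ψ.comp φ) x
      = FilteredClasses.extend P ψ (FilteredClasses.extend P φ x) := by
  obtain ⟨X, rfl⟩ := Quot.exists_rep x
  refine (Quot.sound (X.extendHom_comp _ _ _ ?_ _ _ _ _ _)).symm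
  ext a
  · rfl

/-- The functor `C' ↦ 𝓕(C' ⊗ P₁, …, C' ⊗ P_k)` from commutative `C`-algebras to sets, which sends
the class of `(M', u')` to the class of `(C'' ⊗ M', 1 ⊗ u')` for every morphism `C' → C''`. -/
def moduliFunctor (P : Fin k → DiffModule σ) : CommAlgCat.{u} C ⥤ Type (u + 1) where
  obj C' := FilteredClasses (fun i => (P i).extendScalars C')
  map φ := ↾(FilteredClasses.extend P φ.hom)
  map_id C' := by
    ext x
    exact FilteredClasses.extend_id P C' x
  map_comp φ ψ := by
    ext x
    exact FilteredClasses.extend_comp P φ.hom ψ.hom x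

end Functor

end DifferenceModules
end

/-! Since the graded pieces are projective, a filtered module splits over `K`: it is the direct sum
of the `P i` with semilinear automorphism `U ∘ Φ₀`, where `Φ₀` is diagonal and `U` is unipotent
upper triangular with entries in `Hom_K(P j, P i)`. Equivalences from `U` to `U'` become unipotent
matrices `F` with `F U = U' F^σ`, where `F^σ = Φ₀ F Φ₀⁻¹`. Classes of filtered modules are thus
gauge orbits of unipotent matrices (`exists_equivalent_ofMatrix`, `ofMatrix_equivalent_iff`).

For `i < j` put `Δ f = Φ f Φ⁻¹ - f` on `Hom_K(P j, P i)`. Its kernel is `Hom(P j, P i)`. Its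
cokernel is `Ext(P j, P i)`, because `P j` has a length-one resolution by modules induced from `K`,
which are projective over the Ore ring. (They need not be finitely generated over `K`, so
`SemilinearAut` asks for no finiteness.) Under the hypotheses `Δ` is injective, and if the maps `b
a` lift a basis of `Ext`, every `K`-linear map is uniquely `∑ c a • b a + Δ f` (`exists_cocycles`).

The `(i, j)` entry of the gauge equation equates `U' i j + Δ (F i j)` with `U i j` plus products of
entries at `(i, l)` and `(l, j)`, `i < l < j`. By recursion on `j - i` there are a unique `F` and a
unique `U'` with entries in the span of the `b a` (`existsUnique_normalForm`). The coefficients of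
this normal form are the coordinates of the affine space.

The bijection `(c, f) ↦ ∑ c a • b a + Δ f` is `C`-linear, so it stays bijective after any extension
of scalars. As `P j` is finitely generated projective, the extended map is the analogous one over
`C'` (`bijective_cocycles_extendScalars`). Neither flatness nor a separate study of `Hom` and `Ext`
over `C'` is needed. The same `b` serves every `C'`, and a morphism `C' → C''` acts on coefficients
alone, which is naturality (`extend_classOf`). -/

noncomputable section

namespace DifferenceModules

/-! ### Recursion along a well-founded relation -/

/-- A self-map of a product whose value at `p` depends only on the coordinates below `p` has
a unique fixed point. -/
theorem existsUnique_fixed {ι : Type*} {r : ι → ι → Prop} (hr : WellFounded r) {X : ι → Type*}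
    [∀ p, Nonempty (X p)] (G : (∀ p, X p) → ∀ p, X p)
    (hG : ∀ x y p, (∀ q, r q p → x q = y q) → G x p = G y p) : ∃! x, G x = x := by
  classical
  -- Coordinates not below `p` receive arbitrary values; by `hG` they do not influence the result.
  let F : ∀ p, (∀ q, r q p → X q) → X p := fun p rec =>
    G (fun q => if h : r q p then rec q h else Classical.arbitrary _) p
  refine ⟨hr.fix F, ?_, fun y hy => ?_⟩
  · funext p
    rw [hr.fix_eq]
    exact hG _ _ _ fun q hq => by rw [dif_pos hq]
  · have hx : G (hr.fix F) = hr.fix F := by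
      funext p
      rw [hr.fix_eq]
      exact hG _ _ _ fun q hq => by rw [dif_pos hq]
    funext p
    induction p using hr.induction with
    | _ p ih => rw [← hy, ← hx]; exact hG _ _ _ ih

/-! ### Unipotent matrices and the filtered modules they define -/

section Matrix

variable {C K : Type u} [CommRing C] [CommRing K] [Algebra C K] {σ : K ≃ₐ[C] K} {k : ℕ}

/-- The `σ`-conjugation `f ↦ Φ ∘ f ∘ Φ⁻¹` on `K`-linear maps between difference modules. -/
def DiffModule.conj (M N : DiffModule σ) : (M →ₗ[K] N) →+ (M →ₗ[K] N) where
  toFun f :=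
    { toFun := fun x => N.Φ (f (M.Φ.symm x))
      map_add' := fun x y => by simp
      map_smul' := fun a x => by simp [M.Φ_symm_smul, N.Φ_smul] }
  map_zero' := by ext; simp
  map_add' f g := by ext; simp

theorem DiffModule.conj_apply {M N : DiffModule σ} (f : M →ₗ[K] N) (x : M) :
    M.conj N f x = N.Φ (f (M.Φ.symm x)) := rfl

theorem DiffModule.conj_apply_Φ {M N : DiffModule σ} (f : M →ₗ[K] N) (x : M) :
    M.conj N f (M.Φ x) = N.Φ (f x) := by simp [DiffModule.conj_apply]

theorem DiffModule.conj_id (M : DiffModule σ) : M.conj M LinearMap.id = LinearMap.id := by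
  ext; simp [DiffModule.conj_apply]

/-- The pairs of indices `i < j`. -/
abbrev UpperPair (k : ℕ) : Type := {p : Fin k × Fin k // p.1 < p.2}

variable (P : Fin k → DiffModule σ)

/-- Families of `K`-linear maps `P j → P i`, for `i < j`. -/
abbrev UpperFamily : Type u := ∀ p : UpperPair k, P p.1.2 →ₗ[K] P p.1.1

variable {P}

/-- The unipotent upper triangular matrix with the given entries above the diagonal. -/
def uni (g : UpperFamily P) (i j : Fin k) : P j →ₗ[K] P i :=
  -- The second branch is the identity for `i = j` and zero for `j < i`, without any transport along
  -- `i = j`.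
  if h : i < j then g ⟨(i, j), h⟩ else LinearMap.proj i ∘ₗ LinearMap.single K (fun i => P i) j

theorem uni_of_lt (g : UpperFamily P) {i j : Fin k} (h : i < j) : uni g i j = g ⟨(i, j), h⟩ :=
  dif_pos h

theorem uni_self (g : UpperFamily P) (i : Fin k) : uni g i i = LinearMap.id := by
  ext x
  simp [uni]

theorem uni_of_gt (g : UpperFamily P) {i j : Fin k} (h : j < i) : uni g i j = 0 := by
  ext x
  simp [uni, h.not_gt, Pi.single_eq_of_ne h.ne']

/-- The endomorphism of `∏ P i` with a given matrix. -/
def matLin (A : ∀ i j, P j →ₗ[K] P i) : (∀ i, P i) →ₗ[K] (∀ i, P i) :=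
  LinearMap.pi fun i => ∑ j, A i j ∘ₗ LinearMap.proj j

theorem matLin_apply (A : ∀ i j, P j →ₗ[K] P i) (x : ∀ i, P i) (i : Fin k) :
    matLin A x i = ∑ j, A i j (x j) := by
  simp [matLin]

theorem matLin_single (A : ∀ i j, P j →ₗ[K] P i) (i j : Fin k) (p : P j) :
    matLin A (Pi.single j p) i = A i j p := by
  rw [matLin_apply, Finset.sum_eq_single j]
  · simp
  · intro l _ hl
    simp [Pi.single_eq_of_ne hl]
  · simp

theorem matLin_uni_apply (g : UpperFamily P) (x : ∀ i, P i) (i : Fin k) :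
    matLin (uni g) x i = x i + ∑ j ∈ Finset.Ioi i, uni g i j (x j) := by
  rw [matLin_apply, ← Finset.sum_subset (Finset.subset_univ (Finset.Ici i)),
    ← Finset.Ioi_insert, Finset.sum_insert (by simp), uni_self]
  · rfl
  · intro j _ hj
    rw [uni_of_gt _ (by simpa using hj)]
    rfl

/-- An endomorphism of `∏ P i` is unipotent if it preserves the standard filtration and induces
the identity on the graded pieces. -/
def IsUnipotent (θ : (∀ i, P i) →ₗ[K] (∀ i, P i)) : Prop :=
  ∀ (i : Fin k) (x : ∀ i, P i), (∀ j, i < j → x j = 0) → θ x i = x i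

theorem isUnipotent_matLin (g : UpperFamily P) : IsUnipotent (matLin (uni g)) := by
  intro i x hx
  rw [matLin_uni_apply, Finset.sum_eq_zero, add_zero]
  intro j hj
  rw [hx j (by simpa using hj), map_zero]

theorem IsUnipotent.exists_eq_matLin {θ : (∀ i, P i) →ₗ[K] (∀ i, P i)} (hθ : IsUnipotent θ) :
    ∃ g : UpperFamily P, θ = matLin (uni g) := by
  refine ⟨fun p => LinearMap.proj p.1.1 ∘ₗ θ ∘ₗ LinearMap.single K (fun i => P i) p.1.2, ?_⟩
  refine LinearMap.pi_ext fun j x => funext fun i => ?_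
  rw [matLin_single]
  rcases lt_trichotomy i j with h | rfl | h
  · rw [uni_of_lt _ h]
    rfl
  · rw [uni_self, hθ _ _ fun l hl => Pi.single_eq_of_ne hl.ne' _]
    simp
  · rw [uni_of_gt _ h, hθ _ _ fun l hl => Pi.single_eq_of_ne (h.trans hl).ne' _]
    simp [Pi.single_eq_of_ne h.ne']

/-- Back substitution: the last coordinate is read off first, and each coordinate is then determined
by those of larger index. The recursion runs along `>` on `Fin k`. -/
theorem matLin_uni_bijective (g : UpperFamily P) : Function.Bijective (matLin (uni g)) := by
  rw [Function.bijective_iff_existsUnique]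
  intro y
  have key := existsUnique_fixed (r := fun j i : Fin k => i < j) wellFounded_gt
    (X := fun i => P i) (fun x i => y i - ∑ j ∈ Finset.Ioi i, uni g i j (x j))
    (fun x x' i h => by
      rw [Finset.sum_congr rfl fun j hj => by rw [h j (by simpa using hj)]])
  refine (existsUnique_congr fun x => ?_).1 key
  rw [funext_iff, funext_iff]
  refine forall_congr' fun i => ?_
  rw [matLin_uni_apply, sub_eq_iff_eq_add, eq_comm]

/-- Descending induction on `j`: once the coordinates beyond `j` vanish, `θ` does not change the
coordinate `j`. -/
theorem IsUnipotent.eq_zero_iff {θ : (∀ i, P i) →ₗ[K] (∀ i, P i)} (hθ : IsUnipotent θ) (m : ℕ)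
    (x : ∀ i, P i) :
    (∀ j : Fin k, m ≤ j → θ x j = 0) ↔ ∀ j : Fin k, m ≤ j → x j = 0 := by
  constructor
  · intro h j
    induction j using (wellFounded_gt (α := Fin k)).induction with
    | _ j ih =>
      intro hj
      rw [← hθ j x fun l hl => ih l hl (hj.trans hl.le)]
      exact h j hj
  · intro h j hj
    rw [hθ j x fun l hl => h l (hj.trans hl.le)]
    exact h j hj

instance : Module.Projective K (∀ i, P i) :=
  Module.Projective.of_equiv (DFinsupp.linearEquivFunOnFintype (R := K) (M := fun i => P i))

variable (P) in
/-- The diagonal semilinear automorphism of `∏ P i`. -/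
def prodΦ : (∀ i, P i) ≃+ (∀ i, P i) := AddEquiv.piCongrRight fun i => (P i).Φ

variable (P) in
/-- The direct sum of a family of difference modules. -/
def prodModule : DiffModule σ where
  carrier := ∀ i, P i
  Φ := prodΦ P
  Φ_smul a x := funext fun i => (P i).Φ_smul a (x i)

theorem prodΦ_apply (x : ∀ i, P i) (i : Fin k) : prodΦ P x i = (P i).Φ (x i) := rfl

theorem uni_conj (g : UpperFamily P) (i j : Fin k) :
    uni (fun p => (P p.1.2).conj (P p.1.1) (g p)) i j = (P j).conj (P i) (uni g i j) := by
  rcases lt_trichotomy i j with h | rfl | h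
  · rw [uni_of_lt _ h, uni_of_lt _ h]
  · rw [uni_self, uni_self, DiffModule.conj_id]
  · rw [uni_of_gt _ h, uni_of_gt _ h, map_zero]

/-- The linear automorphism of `∏ P i` given by a unipotent matrix. -/
def uniEquiv (g : UpperFamily P) : (∀ i, P i) ≃ₗ[K] (∀ i, P i) :=
  LinearEquiv.ofBijective _ (matLin_uni_bijective g)

/-- The direct sum of the `P i`, with semilinear automorphism twisted by a unipotent matrix. -/
def twistedModule (g : UpperFamily P) : DiffModule σ where
  carrier := ∀ i, P i
  Φ := (prodΦ P).trans (uniEquiv g).toAddEquiv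
  Φ_smul a x :=
    (congrArg (uniEquiv g) ((prodModule P).Φ_smul a x)).trans (map_smul (uniEquiv g) _ _)

theorem twistedModule_Φ (g : UpperFamily P) (x : ∀ i, P i) :
    (twistedModule g).Φ x = matLin (uni g) (prodΦ P x) := rfl

variable (P) in
/-- The standard filtration of `∏ P i`. -/
def stdFil (m : Fin (k + 1)) : Submodule K (∀ i, P i) where
  -- The `m`-th step has exactly the `m` coordinates `j < m` free, so `i.succ` admits those up to
  -- `i` and `i.castSucc` only those before `i`.
  carrier := {x | ∀ j : Fin k, (m : ℕ) ≤ j → x j = 0}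
  add_mem' hx hy j hj := by simp [hx j hj, hy j hj]
  zero_mem' _ _ := rfl
  smul_mem' a x hx j hj := by simp [hx j hj]

theorem mem_stdFil_succ {i : Fin k} {x : ∀ i, P i} :
    x ∈ stdFil P i.succ ↔ ∀ j, i < j → x j = 0 := Iff.rfl

theorem mem_stdFil_castSucc {i : Fin k} {x : ∀ i, P i} (hx : x ∈ stdFil P i.succ) :
    x ∈ stdFil P i.castSucc ↔ x i = 0 := by
  refine ⟨fun h => h i le_rfl, fun h j hj => ?_⟩
  rcases (show i ≤ j from hj).eq_or_lt with rfl | hlt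
  · exact h
  · exact mem_stdFil_succ.1 hx j hlt

theorem IsUnipotent.mem_stdFil_iff {θ : (∀ i, P i) →ₗ[K] (∀ i, P i)} (hθ : IsUnipotent θ)
    (m : Fin (k + 1)) (x : ∀ i, P i) : θ x ∈ stdFil P m ↔ x ∈ stdFil P m :=
  hθ.eq_zero_iff m x

theorem prodΦ_mem (m : Fin (k + 1)) (x : ∀ i, P i) :
    (prodΦ P x : ∀ i, P i) ∈ stdFil P m ↔ x ∈ stdFil P m :=
  forall_congr' fun j => imp_congr_right fun _ => EmbeddingLike.map_eq_zero_iff (f := (P j).Φ)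

variable (P) in
/-- The projection of a step of the standard filtration onto its graded piece. -/
def stdProj (i : Fin k) : stdFil P i.succ →ₗ[K] P i :=
  LinearMap.proj i ∘ₗ (stdFil P i.succ).subtype

theorem stdProj_surjective (i : Fin k) : Function.Surjective (stdProj P i) := fun p =>
  ⟨⟨Pi.single i p, fun j hj => Pi.single_eq_of_ne (Fin.ne_of_gt (show i < j from hj)) _⟩, by
    simp [stdProj]⟩

/-- The filtered module given by a unipotent matrix. -/
def FilteredModule.ofMatrix (g : UpperFamily P) : FilteredModule P where
  M := twistedModule g
  fil := stdFil P
  fil_zero := (Submodule.eq_bot_iff _).2 fun _ hx => funext fun j => hx j (Nat.zero_le _)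
  fil_last := (Submodule.eq_top_iff'.2 fun _ j hj => absurd j.2 (not_lt.2 hj))
  fil_le _ _ hx j hj := hx j ((Nat.le_succ _).trans hj)
  Φ_mem m x := ((isUnipotent_matLin g).mem_stdFil_iff m _).trans (prodΦ_mem m x)
  v := stdProj P
  v_Φ i x := isUnipotent_matLin g i _ (mem_stdFil_succ.1 ((prodΦ_mem _ _).2 x.2))
  v_surjective := stdProj_surjective
  v_eq_zero _ x := (mem_stdFil_castSucc x.2).symm

end Matrix

/-! ### Reduction of filtered modules to matrices, and the normal form -/

section Splitting

variable {C K : Type u} [CommRing C] [CommRing K] [Algebra C K] {σ : K ≃ₐ[C] K} {k : ℕ}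
  {P : Fin k → DiffModule σ}

theorem FilteredModule.Equivalent.refl (X : FilteredModule P) : X.Equivalent X :=
  ⟨⟨LinearMap.id, fun _ => rfl⟩, fun _ _ hx => hx, fun _ _ => rfl⟩

theorem FilteredModule.Equivalent.trans {X Y Z : FilteredModule P} (hXY : X.Equivalent Y)
    (hYZ : Y.Equivalent Z) : X.Equivalent Z := by
  obtain ⟨f, hf, hfv⟩ := hXY
  obtain ⟨g, hg, hgv⟩ := hYZ
  refine ⟨⟨g.toLin ∘ₗ f.toLin, fun x => ?_⟩, fun i x hx => hg i _ (hf i x hx), fun i x => ?_⟩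
  · simp [f.comm, g.comm]
  · exact (hgv i ⟨f.toLin x, hf _ _ x.2⟩).trans (hfv i x)

theorem FilteredModule.fil_mono (X : FilteredModule P) : Monotone X.fil :=
  Fin.monotone_iff_le_succ.2 X.fil_le

/-- A filtered module with projective graded pieces is isomorphic, as a filtered `K`-module, to
the direct sum of its graded pieces. -/
theorem FilteredModule.exists_splitting (X : FilteredModule P) :
    ∃ e : (∀ i, P i) ≃ₗ[K] X.M, ∃ h : ∀ m x, e x ∈ X.fil m ↔ x ∈ stdFil P m,
      ∀ (i : Fin k) (x : ∀ i, P i) (hx : x ∈ stdFil P i.succ),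
        X.v i ⟨e x, (h _ _).2 hx⟩ = x i := by
  choose s hs using fun i =>
    Module.projective_lifting_property (X.v i) LinearMap.id (X.v_surjective i)
  have hs' : ∀ i p, X.v i (s i p) = p := fun i p => LinearMap.congr_fun (hs i) p
  -- The splitting is the sum of `K`-linear sections `s i` of the epimorphisms onto the graded
  -- pieces.
  let φ : (∀ i, P i) →ₗ[K] X.M :=
    ∑ i, (X.fil i.succ).subtype ∘ₗ s i ∘ₗ LinearMap.proj i
  have hφ : ∀ x, φ x = ∑ i, (s i (x i) : X.M) := fun x => by simp [φ]
  have hφ_single : ∀ i p, φ (Pi.single i p) = s i p := fun i p => by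
    rw [hφ, Finset.sum_eq_single i]
    · simp
    · intro j _ hj
      simp [Pi.single_eq_of_ne hj]
    · simp
  have hmem : ∀ m x, x ∈ stdFil P m → φ x ∈ X.fil m := fun m x hx => by
    rw [hφ]
    refine Submodule.sum_mem _ fun j _ => ?_
    by_cases hj : (m : ℕ) ≤ j
    · simp [hx j hj]
    · exact X.fil_mono (show j.succ ≤ m from not_le.1 hj) (s j (x j)).2
  have hdec : ∀ (i : Fin k) (x), x ∈ stdFil P i.succ →
      x - Pi.single i (x i) ∈ stdFil P i.castSucc := fun i x hx => by
    refine (mem_stdFil_castSucc (Submodule.sub_mem _ hx (mem_stdFil_succ.2 fun j hj => ?_))).2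
      (by simp)
    exact Pi.single_eq_of_ne hj.ne' _
  have hv : ∀ (i : Fin k) (x) (hx : x ∈ stdFil P i.succ), X.v i ⟨φ x, hmem _ _ hx⟩ = x i := by
    intro i x hx
    have h1 : X.v i (⟨φ x, hmem _ _ hx⟩ - s i (x i)) = 0 := by
      rw [X.v_eq_zero]
      have h2 := hmem _ _ (hdec i x hx)
      rwa [map_sub, hφ_single] at h2
    rwa [map_sub, hs', sub_eq_zero] at h1
  -- Induction along the filtration: `v i` reads off the top coordinate of `x`, so this vanishes
  -- with `φ x` and `x` drops one step.
  have hinj : ∀ (m : Fin (k + 1)) (x), x ∈ stdFil P m → φ x = 0 → x = 0 := by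
    intro m
    induction m using Fin.induction with
    | zero => exact fun x hx _ => funext fun j => hx j (Nat.zero_le _)
    | succ i ih =>
      intro x hx h0
      refine ih x ((mem_stdFil_castSucc hx).2 ?_) h0
      rw [← hv i x hx, X.v_eq_zero]
      simp [h0]
  -- Subtracting the section of the top graded component moves `y` one step down. Keeping the
  -- preimage inside `stdFil P m` makes `φ` strict for the filtrations.
  have hsurj : ∀ (m : Fin (k + 1)) (y), y ∈ X.fil m → ∃ x ∈ stdFil P m, φ x = y := by
    intro m
    induction m using Fin.induction with
    | zero =>
      intro y hy
      rw [X.fil_zero, Submodule.mem_bot] at hy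
      exact ⟨0, Submodule.zero_mem _, by rw [hy, map_zero]⟩
    | succ i ih =>
      intro y hy
      obtain ⟨x, hx, hxy⟩ := ih (y - s i (X.v i ⟨y, hy⟩)) (by
        have h1 := (X.v_eq_zero i (⟨y, hy⟩ - s i (X.v i ⟨y, hy⟩))).1 (by
          rw [map_sub, hs', sub_self])
        exact h1)
      refine ⟨x + Pi.single i (X.v i ⟨y, hy⟩), Submodule.add_mem _
        (fun j hj => hx j ((Nat.le_succ _).trans hj))
        (mem_stdFil_succ.2 fun j hj => Pi.single_eq_of_ne hj.ne' _), ?_⟩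
      rw [map_add, hxy, hφ_single, sub_add_cancel]
  have hφ_inj : Function.Injective φ := (injective_iff_map_eq_zero φ).2 fun x hx =>
    hinj (Fin.last k) x (fun j hj => absurd j.2 (not_lt.2 hj)) hx
  let e := LinearEquiv.ofBijective φ ⟨hφ_inj, fun y => by
    obtain ⟨x, -, hx⟩ := hsurj (Fin.last k) y (X.fil_last ▸ Submodule.mem_top)
    exact ⟨x, hx⟩⟩
  refine ⟨e, fun m x => ⟨fun h => ?_, hmem m x⟩, hv⟩
  obtain ⟨x', hx', h'⟩ := hsurj m _ h
  rwa [← hφ_inj h']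

/-- Every filtered module is equivalent to one given by a unipotent matrix. -/
theorem FilteredModule.exists_equivalent_ofMatrix (X : FilteredModule P) :
    ∃ g, (ofMatrix g).Equivalent X ∧ X.Equivalent (ofMatrix g) := by
  obtain ⟨e, he, hv⟩ := X.exists_splitting
  -- `θ = e⁻¹ Φ e Φ₀⁻¹` compares the transported automorphism with the diagonal one; it is linear
  -- because the semilinearities cancel.
  let θ : (∀ i, P i) →ₗ[K] (∀ i, P i) :=
    e.symm.toLinearMap ∘ₗ (prodModule P).conj X.M e.toLinearMap
  have hθΦ : ∀ x : ∀ i, P i, e (θ (prodΦ P x)) = X.M.Φ (e x) := fun x =>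
    (e.apply_symm_apply _).trans (DiffModule.conj_apply_Φ (M := prodModule P) _ x)
  have hθ : IsUnipotent θ := by
    intro i y hy
    obtain ⟨x, rfl⟩ := (prodΦ P).surjective y
    have hx : x ∈ stdFil P i.succ := (prodΦ_mem _ _).1 hy
    have h1 : e (θ (prodΦ P x)) ∈ X.fil i.succ := by
      rw [hθΦ, X.Φ_mem, he]
      exact hx
    rw [← hv i _ ((he _ _).1 h1), prodΦ_apply, ← hv i x hx, ← X.v_Φ]
    exact congrArg (X.v i) (Subtype.ext (hθΦ x))
  obtain ⟨g, hg⟩ := hθ.exists_eq_matLin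
  have hΦ : ∀ x : ∀ i, P i, e ((twistedModule g).Φ x) = X.M.Φ (e x) := fun x => by
    rw [← hθΦ, hg, twistedModule_Φ]
  -- Both directions are recorded, by `e` and `e⁻¹`, so that symmetry of the relation is never
  -- required.
  refine ⟨g, ⟨⟨e.toLinearMap, hΦ⟩, fun m x => (he m x).2, fun i x => hv i x.1 x.2⟩,
    ⟨⟨e.symm.toLinearMap, fun x => ?_⟩, fun m x hx => ?_, fun i x => ?_⟩⟩
  · exact e.injective ((e.apply_symm_apply _).trans
      ((hΦ _).trans (congrArg X.M.Φ (e.apply_symm_apply x))).symm)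
  · exact (he m _).1 ((e.apply_symm_apply x).symm ▸ hx)
  · have h1 : e (e.symm x) ∈ X.fil i.succ := (e.apply_symm_apply (x : X.M)).symm ▸ x.2
    refine (hv i (e.symm x) ((he _ _).1 h1)).symm.trans (congrArg (X.v i) (Subtype.ext ?_))
    exact e.apply_symm_apply _

/-- Morphisms between the filtered modules given by two unipotent matrices. -/
theorem FilteredModule.ofMatrix_equivalent_iff (g h : UpperFamily P) :
    (ofMatrix g).Equivalent (ofMatrix h) ↔ ∃ f : UpperFamily P,
      matLin (uni f) ∘ₗ matLin (uni g) =
        matLin (uni h) ∘ₗ matLin (uni fun p => (P p.1.2).conj (P p.1.1) (f p)) := by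
  -- Entrywise conjugation is conjugation of the whole matrix by the diagonal automorphism.
  have hconj : ∀ (f : UpperFamily P) (x : ∀ i, P i),
      matLin (uni fun p => (P p.1.2).conj (P p.1.1) (f p)) (prodΦ P x) =
        prodΦ P (matLin (uni f) x) := fun f x => funext fun i => by
    rw [matLin_apply, prodΦ_apply, matLin_apply, map_sum]
    refine Finset.sum_congr rfl fun j _ => ?_
    rw [uni_conj, prodΦ_apply, DiffModule.conj_apply_Φ]
  constructor
  · rintro ⟨F, hF, hv⟩
    have hF' : IsUnipotent (P := P) F.toLin := fun i x hx => hv i ⟨x, hx⟩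
    obtain ⟨f, hf⟩ := hF'.exists_eq_matLin
    refine ⟨f, LinearMap.ext fun y => ?_⟩
    obtain ⟨x, rfl⟩ := (prodΦ P).surjective y
    rw [LinearMap.comp_apply, LinearMap.comp_apply, hconj, ← hf]
    exact F.comm x
  · rintro ⟨f, hf⟩
    refine ⟨⟨matLin (uni f), fun x => ?_⟩,
      fun m x => ((isUnipotent_matLin f).mem_stdFil_iff m x).2,
      fun i x => isUnipotent_matLin f i _ x.2⟩
    exact (LinearMap.congr_fun hf (prodΦ P x)).trans
      (congrArg (matLin (uni h)) (hconj f x))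

theorem matLin_comp_apply_single (A B : ∀ i j, P j →ₗ[K] P i) (i j : Fin k) (x : P j) :
    (matLin A ∘ₗ matLin B) (Pi.single j x) i = ∑ l, A i l (B l j x) := by
  rw [LinearMap.comp_apply, matLin_apply]
  simp_rw [matLin_single]

/-- Triangularity leaves only `i ≤ l ≤ j`, and the identities on the diagonal reduce the two end
terms to bare entries. The remaining sum involves only pairs of smaller difference, which makes the
recursion on `j - i` possible. -/
theorem sum_uni_comp_uni (f g : UpperFamily P) (p : UpperPair k) :
    ∑ l, uni f p.1.1 l ∘ₗ uni g l p.1.2 =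
      g p + f p + ∑ l ∈ Finset.Ioo p.1.1 p.1.2, uni f p.1.1 l ∘ₗ uni g l p.1.2 := by
  obtain ⟨⟨i, j⟩, hij : i < j⟩ := p
  rw [← Finset.sum_subset (Finset.subset_univ (Finset.Icc i j)),
    ← Finset.Ioc_insert_left hij.le, Finset.sum_insert (by simp),
    ← Finset.Ioo_insert_right hij, Finset.sum_insert (by simp), uni_self, uni_self,
    uni_of_lt _ hij, uni_of_lt _ hij, LinearMap.id_comp, LinearMap.comp_id, add_assoc]
  intro l _ hl
  rw [Finset.mem_Icc, not_and_or, not_le, not_le] at hl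
  rcases hl with hl | hl
  · rw [uni_of_gt _ hl, LinearMap.zero_comp]
  · rw [uni_of_gt _ hl, LinearMap.comp_zero]

/-- A product of unipotent matrices is unipotent, so on and below the diagonal there is nothing to
compare. -/
theorem matLin_comp_eq_iff (f g f' g' : UpperFamily P) :
    matLin (uni f) ∘ₗ matLin (uni g) = matLin (uni f') ∘ₗ matLin (uni g') ↔
      ∀ p : UpperPair k,
        g p + f p + ∑ l ∈ Finset.Ioo p.1.1 p.1.2, uni f p.1.1 l ∘ₗ uni g l p.1.2 =
          g' p + f' p + ∑ l ∈ Finset.Ioo p.1.1 p.1.2, uni f' p.1.1 l ∘ₗ uni g' l p.1.2 := by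
  simp_rw [← sum_uni_comp_uni]
  constructor
  · intro h p
    ext x
    have := congrFun (LinearMap.congr_fun h (Pi.single p.1.2 x)) p.1.1
    simpa [matLin_comp_apply_single] using this
  · intro h
    refine LinearMap.pi_ext fun j x => funext fun i => ?_
    rw [matLin_comp_apply_single, matLin_comp_apply_single]
    rcases lt_or_ge i j with hij | hij
    · simpa using LinearMap.congr_fun (h ⟨(i, j), hij⟩) x
    · have key : ∀ f g : UpperFamily P, ∑ l, uni f i l (uni g l j x) = uni f i j x := by
        intro f g
        rw [Finset.sum_eq_single j]
        · rw [uni_self, LinearMap.id_apply]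
        · intro l _ hl
          rcases hl.lt_or_gt with hl | hl
          · rw [uni_of_gt f (hl.trans_le hij), LinearMap.zero_apply]
          · rw [uni_of_gt g hl, LinearMap.zero_apply, map_zero]
        · simp
      rw [key, key]
      rcases hij.eq_or_lt with rfl | hij
      · rw [uni_self, uni_self]
      · rw [uni_of_gt _ hij, uni_of_gt _ hij]

/-- If, for all `i < j`, every `K`-linear map `P j → P i` is uniquely of the form
`b s + (Φ ∘ f ∘ Φ⁻¹ - f)`, then every unipotent matrix is gauge equivalent to a unique one with
entries in the image of `b`. -/
theorem existsUnique_normalForm {S : UpperPair k → Type*}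
    (b : ∀ p : UpperPair k, S p → (P p.1.2 →ₗ[K] P p.1.1))
    (hb : ∀ p, Function.Bijective fun sf : S p × (P p.1.2 →ₗ[K] P p.1.1) =>
      b p sf.1 + ((P p.1.2).conj (P p.1.1) sf.2 - sf.2)) (g : UpperFamily P) :
    ∃! x : ∀ p, S p × (P p.1.2 →ₗ[K] P p.1.1),
      matLin (uni fun p => (x p).2) ∘ₗ matLin (uni g) =
        matLin (uni fun p => b p (x p).1) ∘ₗ
          matLin (uni fun p => (P p.1.2).conj (P p.1.1) (x p).2) := by
  let ψ := fun p => Equiv.ofBijective _ (hb p)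
  -- `R x p` is what the gauge equation at `p` prescribes for `b s + (Φ f Φ⁻¹ - f)`; it uses `x`
  -- only at pairs strictly inside `p`, so applying `ψ p` inverse solves for `x p`.
  let R : (∀ p, S p × (P p.1.2 →ₗ[K] P p.1.1)) → ∀ p : UpperPair k, P p.1.2 →ₗ[K] P p.1.1 :=
    fun x p => g p +
      (∑ l ∈ Finset.Ioo p.1.1 p.1.2, uni (fun p => (x p).2) p.1.1 l ∘ₗ uni g l p.1.2 -
       ∑ l ∈ Finset.Ioo p.1.1 p.1.2, uni (fun p => b p (x p).1) p.1.1 l ∘ₗ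
        uni (fun p => (P p.1.2).conj (P p.1.1) (x p).2) l p.1.2)
  have : ∀ p, Nonempty (S p × (P p.1.2 →ₗ[K] P p.1.1)) := fun p => ⟨(ψ p).symm 0⟩
  have key := existsUnique_fixed
    (InvImage.wf (fun p : UpperPair k => (p.1.2 : ℕ) - p.1.1) Nat.lt_wfRel.wf)
    (fun x p => (ψ p).symm (R x p)) (fun x y p hxy => by
      obtain ⟨⟨i, j⟩, hij : i < j⟩ := p
      refine congrArg _ (congrArg (g _ + ·) (congrArg₂ (· - ·) ?_ ?_)) <;>
      refine Finset.sum_congr rfl fun l hl => ?_ <;>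
      obtain ⟨h1, h2⟩ : i < l ∧ l < j := by simpa using hl
      all_goals
        have e1 : x ⟨(i, l), h1⟩ = y ⟨(i, l), h1⟩ := hxy _ (by
          simp only [InvImage, WellFoundedRelation.rel, Fin.lt_def] at *; omega)
        have e2 : x ⟨(l, j), h2⟩ = y ⟨(l, j), h2⟩ := hxy _ (by
          simp only [InvImage, WellFoundedRelation.rel] at *; omega)
        simp only [uni_of_lt _ h1, uni_of_lt _ h2, e1, e2])
  refine (existsUnique_congr fun x => ?_).1 key
  rw [matLin_comp_eq_iff, funext_iff]
  refine forall_congr' fun p => ?_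
  rw [Equiv.symm_apply_eq]
  change g p + (_ - _) = b p (x p).1 + ((P p.1.2).conj (P p.1.1) (x p).2 - (x p).2) ↔ _
  constructor <;> intro h
  · rw [add_sub_assoc', sub_eq_iff_eq_add] at h
    rw [add_right_comm, h]
    abel
  · rw [add_sub_assoc', sub_eq_iff_eq_add]
    rw [add_right_comm, ← eq_sub_iff_add_eq] at h
    rw [h]
    abel

/-- Under the hypothesis of `existsUnique_normalForm`, the classes of filtered modules are
parametrized by the products of the parameter sets. -/
theorem bijective_mk_ofMatrix {S : UpperPair k → Type*}
    (b : ∀ p : UpperPair k, S p → (P p.1.2 →ₗ[K] P p.1.1))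
    (hb : ∀ p, Function.Bijective fun sf : S p × (P p.1.2 →ₗ[K] P p.1.1) =>
      b p sf.1 + ((P p.1.2).conj (P p.1.1) sf.2 - sf.2)) :
    Function.Bijective fun s : ∀ p, S p =>
      (Quot.mk _ (FilteredModule.ofMatrix fun p => b p (s p)) : FilteredClasses P) := by
  have hex : ∀ X : FilteredModule P, ∃! s : ∀ p, S p,
      X.Equivalent (FilteredModule.ofMatrix fun p => b p (s p)) := by
    intro X
    obtain ⟨g, hg, hg'⟩ := X.exists_equivalent_ofMatrix
    obtain ⟨x, hx, hu⟩ := existsUnique_normalForm b hb g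
    refine ⟨fun p => (x p).1, hg'.trans
      ((FilteredModule.ofMatrix_equivalent_iff _ _).2 ⟨_, hx⟩), fun s hs => ?_⟩
    obtain ⟨f, hf⟩ := (FilteredModule.ofMatrix_equivalent_iff _ _).1 (hg.trans hs)
    have := hu (fun p => (s p, f p)) hf
    exact funext fun p => congrArg Prod.fst (congrFun this p)
  choose nf hnf hnf' using hex
  -- By transitivity `X` also maps to the normal form of `Y`, and uniqueness applies.
  have hinv : ∀ X Y : FilteredModule P, X.Equivalent Y → nf X = nf Y := fun X Y h =>
    (hnf' X _ (h.trans (hnf Y))).symm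
  constructor
  · intro s t hst
    -- Equality in the quotient is tested through the invariant `nf`; it need not be unfolded to an
    -- actual equivalence.
    have h := congrArg (Quot.lift nf hinv) hst
    exact (hnf' _ s (FilteredModule.Equivalent.refl _)).trans
      (Eq.trans h (hnf' _ t (FilteredModule.Equivalent.refl _)).symm)
  · intro X
    obtain ⟨X, rfl⟩ := Quot.exists_rep X
    exact ⟨nf X, (Quot.sound (hnf X)).symm⟩

end Splitting

/-! ### Modules over the Ore ring -/

section OreModules

variable {C K : Type u} [CommRing C] [CommRing K] [Algebra C K] {σ : K ≃ₐ[C] K}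

variable (σ) in
/-- The inclusion of `K` in the Ore ring. -/
def oreC : K →+* OreRing σ :=
  letI := oreAction σ
  SkewMonoidAlgebra.singleOneRingHom

variable (σ) in
/-- The monomial `σⁿ` of the Ore ring. -/
def oreMonomial : Multiplicative ℤ →* OreRing σ :=
  letI := oreAction σ
  SkewMonoidAlgebra.of K (Multiplicative ℤ)

variable (σ) in
/-- The element `σ` of the Ore ring, as a unit. -/
def oreGen : (OreRing σ)ˣ :=
  Units.map (oreMonomial σ) (toUnits (Multiplicative.ofAdd 1))

theorem oreGen_mul_oreC (a : K) : (oreGen σ : OreRing σ) * oreC σ a = oreC σ (σ a) * oreGen σ := by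
  let _ := oreAction σ
  refine (SkewMonoidAlgebra.single_mul_single (a₁ := Multiplicative.ofAdd (1 : ℤ)) (a₂ := 1)
    (b₁ := (1 : K)) (b₂ := a)).trans (Eq.trans ?_ (SkewMonoidAlgebra.single_mul_single
      (a₁ := 1) (a₂ := Multiplicative.ofAdd (1 : ℤ)) (b₁ := σ a) (b₂ := 1)).symm)
  simp only [mul_one, one_mul, smul_one]
  congr 1

/-- Every element is a finite sum of monomials `a σⁿ`, so `K`, `σ` and `σ⁻¹` generate the ring. -/
theorem oreRing_induction {p : OreRing σ → Prop} (zero : p 0) (add : ∀ x y, p x → p y → p (x + y))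
    (mul : ∀ x y, p x → p y → p (x * y)) (hC : ∀ a, p (oreC σ a)) (hgen : p (oreGen σ))
    (hinv : p ((oreGen σ)⁻¹ : (OreRing σ)ˣ)) (x : OreRing σ) : p x := by
  let _ := oreAction σ
  have hpow : ∀ n : ℤ, p ((oreGen σ ^ n : (OreRing σ)ˣ) : OreRing σ) := by
    intro n
    induction n with
    | zero => simpa using hC 1
    | succ n ih => rw [zpow_add_one, Units.val_mul]; exact mul _ _ ih hgen
    | pred n ih => rw [zpow_sub_one, Units.val_mul]; exact mul _ _ ih hinv
  refine SkewMonoidAlgebra.induction_on (p := p) x zero (fun n a => ?_) fun {f g} => add f g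
  have h := mul _ _ (hC a) (hpow n.toAdd)
  have e : oreC σ a * ((oreGen σ ^ n.toAdd : (OreRing σ)ˣ) : OreRing σ) =
      SkewMonoidAlgebra.single n a := by
    rw [oreGen, ← map_zpow, Units.coe_map]
    refine (SkewMonoidAlgebra.single_mul_single (a₁ := 1) (b₁ := a) (b₂ := 1)).trans ?_
    simp [← ofAdd_zsmul]
  rwa [e] at h

/-- Used to identify the `C`-action on morphisms of modules over the Ore ring with scalar
multiplication through `K`. -/
theorem algebraMap_oreRing (c : C) :
    algebraMap C (OreRing σ) c = oreC σ (algebraMap C K c) := by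
  let _ := oreAction σ
  have := oreAction_smulCommClass σ
  change algebraMap C (SkewMonoidAlgebra K (Multiplicative ℤ)) c = SkewMonoidAlgebra.single 1 _
  rw [Algebra.algebraMap_eq_smul_one, SkewMonoidAlgebra.one_def, SkewMonoidAlgebra.smul_single,
    Algebra.algebraMap_eq_smul_one]

theorem ring_mul_smul {D A : Type*} [Ring D] [AddCommGroup A] [Module D A] (r s : D) (x : A) :
    (r * s) • x = r • s • x := mul_smul r s x

/-- A map compatible with the actions of `K` and of `σ` is linear over the Ore ring. -/
def oreLinear {A B : Type*} [AddCommGroup A] [AddCommGroup B] [Module (OreRing σ) A]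
    [Module (OreRing σ) B] (f : A →+ B) (hC : ∀ (a : K) x, f (oreC σ a • x) = oreC σ a • f x)
    (hgen : ∀ x, f ((oreGen σ : OreRing σ) • x) = (oreGen σ : OreRing σ) • f x) :
    A →ₗ[OreRing σ] B where
  toFun := f
  map_add' := map_add f
  map_smul' r := by
    refine oreRing_induction (p := fun r => ∀ x, f (r • x) = r • f x) (by simp)
      (fun r s hr hs x => by rw [add_smul, add_smul, map_add, hr, hs])
      (fun r s hr hs x => by
        rw [ring_mul_smul, ring_mul_smul, hr, hs]) hC hgen (fun x => ?_) r
    -- Compatibility with `σ⁻¹` follows from that with `σ`, since `σ` acts invertibly on the target.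
    have h : (oreGen σ : OreRing σ) • f (((oreGen σ)⁻¹ : (OreRing σ)ˣ) • x) = f x := by
      rw [← hgen, ← Units.smul_def, smul_inv_smul]
    rw [← Units.smul_def, ← Units.smul_def, eq_inv_smul_iff, Units.smul_def, h]

variable (σ) in
/-- A `σ`-linear automorphism of a `K`-module. -/
structure SemilinearAut (E : Type u) [AddCommGroup E] [Module K E] where
  /-- The underlying additive automorphism. -/
  Φ : E ≃+ E
  Φ_smul : ∀ (a : K) (x : E), Φ (a • x) = σ a • Φ x

variable {E F : Type u} [AddCommGroup E] [Module K E] [AddCommGroup F] [Module K F]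

theorem SemilinearAut.Φ_symm_smul (S : SemilinearAut σ E) (a : K) (x : E) :
    S.Φ.symm (a • x) = σ.symm a • S.Φ.symm x := by
  apply S.Φ.injective
  simp [S.Φ_smul]

/-- The automorphism as a unit of the ring of additive endomorphisms. -/
def SemilinearAut.unitΦ (S : SemilinearAut σ E) : (AddMonoid.End E)ˣ where
  val := S.Φ.toAddMonoidHom
  inv := S.Φ.symm.toAddMonoidHom
  val_inv := AddMonoidHom.ext fun x => S.Φ.apply_symm_apply x
  inv_val := AddMonoidHom.ext fun x => S.Φ.symm_apply_apply x

theorem SemilinearAut.unitΦ_zpow_smul (S : SemilinearAut σ E) (n : ℤ) (a : K) (x : E) :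
    ((S.unitΦ ^ n : (AddMonoid.End E)ˣ) : AddMonoid.End E) (a • x)
      = (σ ^ n) a • ((S.unitΦ ^ n : (AddMonoid.End E)ˣ) : AddMonoid.End E) x := by
  induction n with
  | zero => simp
  | succ n ih =>
    rw [add_comm, zpow_one_add, zpow_one_add, Units.val_mul, AddMonoid.End.coe_mul,
      Function.comp_apply, Function.comp_apply, ih]
    exact S.Φ_smul _ _
  | pred n ih =>
    rw [sub_eq_neg_add, zpow_add, zpow_add, zpow_neg_one, zpow_neg_one, Units.val_mul,
      AddMonoid.End.coe_mul, Function.comp_apply, Function.comp_apply, ih]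
    exact S.Φ_symm_smul _ _

/-- The action of the Ore ring given by a semilinear automorphism. -/
def SemilinearAut.oreHom (S : SemilinearAut σ E) : OreRing σ →+* AddMonoid.End E :=
  letI := oreAction σ
  SkewMonoidAlgebra.liftNCRingHom (Module.toAddMonoidEnd K E)
    ((Units.coeHom (AddMonoid.End E)).comp (zpowersHom _ S.unitΦ)) (by
      intro a n
      ext x
      exact (S.unitΦ_zpow_smul n.toAdd a x).symm)

/-- A `K`-module with a semilinear automorphism, as a left module over the Ore ring. -/
def SemilinearAut.toModuleCat (S : SemilinearAut σ E) : ModuleCat.{u} (OreRing σ) :=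
  letI : Module (OreRing σ) E := Module.compHom E S.oreHom
  ModuleCat.of (OreRing σ) E

theorem SemilinearAut.oreC_smul (S : SemilinearAut σ E) (a : K) (x : S.toModuleCat) :
    oreC σ a • x = (a • (show E from x) : E) := by
  let _ := oreAction σ
  refine (DFunLike.congr_fun (F := AddMonoid.End E)
    (SkewMonoidAlgebra.liftNC_single _ _ (1 : Multiplicative ℤ) a) x).trans ?_
  simp
  rfl

theorem SemilinearAut.oreGen_smul (S : SemilinearAut σ E) (x : S.toModuleCat) :
    (oreGen σ : OreRing σ) • x = S.Φ x := by
  let _ := oreAction σ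
  refine (DFunLike.congr_fun (F := AddMonoid.End E)
    (SkewMonoidAlgebra.liftNC_single _ _ (Multiplicative.ofAdd (1 : ℤ)) (1 : K)) x).trans ?_
  simp
  rfl

/-- The semilinear automorphism of a difference module. -/
def DiffModule.semilinearAut (M : DiffModule σ) : SemilinearAut σ M := ⟨M.Φ, M.Φ_smul⟩

/-- A `K`-linear map commuting with the semilinear automorphisms, as a morphism of modules over
the Ore ring. -/
def SemilinearAut.hom {S : SemilinearAut σ E} {T : SemilinearAut σ F} (f : E →ₗ[K] F)
    (hf : ∀ x, f (S.Φ x) = T.Φ (f x)) : S.toModuleCat ⟶ T.toModuleCat :=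
  ModuleCat.ofHom (X := S.toModuleCat) (Y := T.toModuleCat) (oreLinear (A := S.toModuleCat)
    (B := T.toModuleCat) f.toAddMonoidHom
    (fun a x => by
      exact (congrArg f (S.oreC_smul a x)).trans ((map_smul f a _).trans (T.oreC_smul a _).symm))
    (fun x => by
      exact (congrArg f (S.oreGen_smul x)).trans ((hf x).trans (T.oreGen_smul _).symm)))

/-- The `K`-linear map underlying a morphism of modules over the Ore ring. -/
def SemilinearAut.lin {S : SemilinearAut σ E} {T : SemilinearAut σ F}
    (φ : S.toModuleCat ⟶ T.toModuleCat) : E →ₗ[K] F where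
  toFun x := φ.hom x
  map_add' x y := map_add φ.hom (show S.toModuleCat from x) (show S.toModuleCat from y)
  map_smul' a x := by
    have h := map_smul φ.hom (oreC σ a) (show S.toModuleCat from x)
    rw [S.oreC_smul, T.oreC_smul] at h
    exact h

theorem SemilinearAut.lin_Φ {S : SemilinearAut σ E} {T : SemilinearAut σ F}
    (φ : S.toModuleCat ⟶ T.toModuleCat) (x : E) : lin φ (S.Φ x) = T.Φ (lin φ x) := by
  have h := map_smul φ.hom (oreGen σ : OreRing σ) (show S.toModuleCat from x)
  rw [S.oreGen_smul, T.oreGen_smul] at h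
  exact h

theorem SemilinearAut.lin_injective {S : SemilinearAut σ E} {T : SemilinearAut σ F}
    {φ ψ : S.toModuleCat ⟶ T.toModuleCat} (h : lin φ = lin ψ) : φ = ψ :=
  ModuleCat.hom_ext (LinearMap.ext fun x => LinearMap.congr_fun h x)

/-! ### The induced module of a difference module -/

/-- The conjugation `f ↦ Φ ∘ f ∘ Φ⁻¹`, as a permutation. -/
def SemilinearAut.conj (S : SemilinearAut σ E) (T : SemilinearAut σ F) :
    Equiv.Perm (E →ₗ[K] F) where
  toFun f :=
    { toFun := fun x => T.Φ (f (S.Φ.symm x))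
      map_add' := fun x y => by simp
      map_smul' := fun a x => by simp [S.Φ_symm_smul, T.Φ_smul] }
  invFun f :=
    { toFun := fun x => T.Φ.symm (f (S.Φ x))
      map_add' := fun x y => by simp
      map_smul' := fun a x => by simp [S.Φ_smul, T.Φ_symm_smul] }
  left_inv f := by ext; simp
  right_inv f := by ext; simp

theorem SemilinearAut.conj_apply (S : SemilinearAut σ E) (T : SemilinearAut σ F) (f : E →ₗ[K] F)
    (x : E) : S.conj T f x = T.Φ (f (S.Φ.symm x)) := rfl

/-- The module induced from `K` to the Ore ring: `single n x` stands for `σⁿ ⊗ Φ⁻ⁿ x`. -/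
def SemilinearAut.induced (S : SemilinearAut σ E) : SemilinearAut σ (ℤ →₀ E) where
  -- Indeed `σ (σⁿ ⊗ Φ⁻ⁿ x) = σⁿ⁺¹ ⊗ Φ⁻ⁿ⁻¹ (Φ x)`. The normalization by `Φ⁻ⁿ` makes `K` act
  -- coordinatewise.
  Φ := (Finsupp.domCongr (Equiv.addRight (1 : ℤ))).trans (Finsupp.mapRange.addEquiv S.Φ)
  Φ_smul a x := by
    ext n
    simp [S.Φ_smul]

theorem SemilinearAut.induced_Φ_single (S : SemilinearAut σ E) (n : ℤ) (x : E) :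
    S.induced.Φ (Finsupp.single n x) = Finsupp.single (n + 1) (S.Φ x) := by
  simp [SemilinearAut.induced]

/-- The extension of a `K`-linear map to the induced module. -/
def SemilinearAut.extend (S : SemilinearAut σ E) (T : SemilinearAut σ F) (f : E →ₗ[K] F) :
    (ℤ →₀ E) →ₗ[K] F :=
  -- Equivariance forces the value on `σⁿ ⊗ Φ⁻ⁿ x` to be `Tⁿ f (S⁻ⁿ x)`.
  Finsupp.lsum ℕ fun n : ℤ => (S.conj T ^ n : Equiv.Perm (E →ₗ[K] F)) f

theorem SemilinearAut.extend_single (S : SemilinearAut σ E) (T : SemilinearAut σ F)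
    (f : E →ₗ[K] F) (n : ℤ) (x : E) :
    S.extend T f (Finsupp.single n x) = (S.conj T ^ n : Equiv.Perm (E →ₗ[K] F)) f x := by
  simp [SemilinearAut.extend]

theorem SemilinearAut.conj_zpow_add_one (S : SemilinearAut σ E) (T : SemilinearAut σ F) (n : ℤ)
    (f : E →ₗ[K] F) : (S.conj T ^ (n + 1) : Equiv.Perm (E →ₗ[K] F)) f =
      S.conj T ((S.conj T ^ n : Equiv.Perm (E →ₗ[K] F)) f) := by
  rw [add_comm, zpow_one_add]
  rfl

theorem SemilinearAut.extend_Φ (S : SemilinearAut σ E) (T : SemilinearAut σ F) (f : E →ₗ[K] F)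
    (x : ℤ →₀ E) : S.extend T f (S.induced.Φ x) = T.Φ (S.extend T f x) := by
  induction x using Finsupp.induction_linear with
  | zero => simp
  | add x y hx hy => simp only [map_add, hx, hy]
  | single n x =>
    rw [S.induced_Φ_single, extend_single, extend_single, conj_zpow_add_one, conj_apply,
      AddEquiv.symm_apply_apply]

/-- A map commuting with the semilinear automorphisms is determined by its restriction to the
component of index zero. -/
theorem SemilinearAut.extend_comp_lsingle (S : SemilinearAut σ E) (T : SemilinearAut σ F)
    (φ : (ℤ →₀ E) →ₗ[K] F) (hφ : ∀ x, φ (S.induced.Φ x) = T.Φ (φ x)) :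
    S.extend T (φ ∘ₗ Finsupp.lsingle 0) = φ := by
  have step : ∀ n : ℤ, S.conj T (φ ∘ₗ Finsupp.lsingle n) = φ ∘ₗ Finsupp.lsingle (n + 1) := by
    intro n
    ext x
    rw [conj_apply, LinearMap.comp_apply, LinearMap.comp_apply, Finsupp.lsingle_apply,
      Finsupp.lsingle_apply, ← hφ, S.induced_Φ_single, AddEquiv.apply_symm_apply]
  have key : ∀ n : ℤ, (S.conj T ^ n : Equiv.Perm (E →ₗ[K] F)) (φ ∘ₗ Finsupp.lsingle 0) =
      φ ∘ₗ Finsupp.lsingle n := by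
    intro n
    induction n with
    | zero => rfl
    | succ n ih => rw [conj_zpow_add_one, ih, step]
    | pred n ih =>
      apply (S.conj T).injective
      rw [← conj_zpow_add_one, step, sub_add_cancel, ih]
  refine Finsupp.lhom_ext fun n x => ?_
  rw [extend_single, key]
  rfl

theorem SemilinearAut.extend_comp_lsingle_zero (S : SemilinearAut σ E) (T : SemilinearAut σ F)
    (f : E →ₗ[K] F) : S.extend T f ∘ₗ Finsupp.lsingle 0 = f := by
  ext x
  simp [extend_single]

/-- The module induced from a projective module is projective. -/
theorem SemilinearAut.projective_induced [Module.Projective K E] (S : SemilinearAut σ E) :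
    Projective S.induced.toModuleCat where
  factors {A B} f e he := by
    -- Restricted to `K`, the modules `A` and `B` carry the action of `σ` as a semilinear
    -- automorphism.
    let _ : Module K A := Module.compHom A (oreC σ)
    let _ : Module K B := Module.compHom B (oreC σ)
    let TA : SemilinearAut σ A :=
      ⟨DistribMulAction.toAddEquiv _ (oreGen σ), fun a x => by
        change (oreGen σ : OreRing σ) • oreC σ a • x = oreC σ (σ a) • (oreGen σ : OreRing σ) • x
        rw [← ring_mul_smul, oreGen_mul_oreC, ring_mul_smul]⟩
    let TB : SemilinearAut σ B :=
      ⟨DistribMulAction.toAddEquiv _ (oreGen σ), fun a x => by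
        change (oreGen σ : OreRing σ) • oreC σ a • x = oreC σ (σ a) • (oreGen σ : OreRing σ) • x
        rw [← ring_mul_smul, oreGen_mul_oreC, ring_mul_smul]⟩
    let e' : A →ₗ[K] B := { e.hom with map_smul' := fun a x => map_smul e.hom (oreC σ a) x }
    let f' : (ℤ →₀ E) →ₗ[K] B :=
      { toFun := fun x => f.hom x
        map_add' := fun x y => map_add f.hom _ _
        map_smul' := fun a x => by
          exact (congrArg f.hom (S.induced.oreC_smul a x)).symm.trans (map_smul f.hom (oreC σ a) _) }
    have hf' : ∀ x, f' (S.induced.Φ x) = TB.Φ (f' x) := fun x => by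
      exact (congrArg f.hom (S.induced.oreGen_smul x)).symm.trans
        (map_smul f.hom (oreGen σ : OreRing σ) _)
    -- Frobenius reciprocity: it suffices to lift the component of index zero over `K`, where `E` is
    -- projective, and then to extend equivariantly.
    obtain ⟨l, hl⟩ := Module.projective_lifting_property e' (f' ∘ₗ Finsupp.lsingle 0)
      ((ModuleCat.epi_iff_surjective e).1 he)
    refine ⟨ModuleCat.ofHom (X := S.induced.toModuleCat) (oreLinear
      (A := S.induced.toModuleCat) (S.extend TA l).toAddMonoidHom (fun a x => ?_) fun x => ?_), ?_⟩
    · exact (congrArg (S.extend TA l) (S.induced.oreC_smul a x)).trans (map_smul (S.extend TA l) a _)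
    · exact (congrArg (S.extend TA l) (S.induced.oreGen_smul x)).trans (S.extend_Φ TA l x)
    · have h : e' ∘ₗ S.extend TA l = f' := by
        rw [← S.extend_comp_lsingle TB f' hf', ← hl,
          ← S.extend_comp_lsingle TB (e' ∘ₗ S.extend TA l), LinearMap.comp_assoc,
          S.extend_comp_lsingle_zero]
        intro x
        rw [LinearMap.comp_apply, S.extend_Φ]
        exact map_smul e.hom (oreGen σ : OreRing σ) (S.extend TA l x)
      exact ModuleCat.hom_ext (LinearMap.ext fun x => LinearMap.congr_fun h x)

end OreModules

/-! ### The two-term resolution by induced modules -/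

section ExtComputation

variable {C K : Type u} [CommRing C] [CommRing K] [Algebra C K] {σ : K ≃ₐ[C] K}
  {E F : Type u} [AddCommGroup E] [Module K E] [AddCommGroup F] [Module K F]

/-- The map `shift - 1` on the induced module. -/
def shiftSub (K E : Type u) [CommRing K] [AddCommGroup E] [Module K E] :
    (ℤ →₀ E) →ₗ[K] (ℤ →₀ E) :=
  Finsupp.lmapDomain E K (· + 1) - LinearMap.id

theorem shiftSub_single (n : ℤ) (x : E) :
    shiftSub K E (Finsupp.single n x) = Finsupp.single (n + 1) x - Finsupp.single n x := by
  simp [shiftSub]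

theorem shiftSub_apply (x : ℤ →₀ E) (n : ℤ) : shiftSub K E x (n + 1) = x n - x (n + 1) := by
  rw [shiftSub, LinearMap.sub_apply, Finsupp.sub_apply, LinearMap.id_apply,
    Finsupp.lmapDomain_apply, Finsupp.mapDomain_apply (add_left_injective (1 : ℤ))]

/-- An element of the kernel is invariant under translation, hence constant on `ℤ`, and finite
support forces it to vanish. -/
theorem shiftSub_injective : Function.Injective (shiftSub K E) := by
  refine (injective_iff_map_eq_zero _).2 fun x hx => ?_
  have h1 : ∀ n, x n = x (n + 1) := fun n => by
    rw [← sub_eq_zero, ← shiftSub_apply (K := K), hx, Finsupp.zero_apply]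
  have h2 : ∀ n, x n = x 0 := by
    intro n
    induction n with
    | zero => rfl
    | succ n ih => rw [← h1, ih]
    | pred n ih => rw [h1, sub_add_cancel, ih]
  obtain ⟨m, hm⟩ := Infinite.exists_notMem_finset x.support
  ext n
  rw [h2, ← h2 m, Finsupp.notMem_support_iff.1 hm, Finsupp.zero_apply]

/-- The sum of the coefficients. -/
def coeffSum (K E : Type u) [CommRing K] [AddCommGroup E] [Module K E] : (ℤ →₀ E) →ₗ[K] E :=
  Finsupp.lsum ℕ fun _ : ℤ => LinearMap.id

theorem coeffSum_single (n : ℤ) (x : E) : coeffSum K E (Finsupp.single n x) = x := by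
  simp [coeffSum]

theorem coeffSum_comp_shiftSub : coeffSum K E ∘ₗ shiftSub K E = 0 := by
  refine Finsupp.lhom_ext fun n x => ?_
  simp [shiftSub_single, coeffSum_single]

/-- Modulo the image of the shift minus one, every `single n x` is congruent to `single 0 x`, so
every `y` is congruent to its coefficient sum placed at index zero. -/
theorem exact_shiftSub_coeffSum : Function.Exact (shiftSub K E) (coeffSum K E) := by
  intro y
  refine ⟨fun hy => ?_, fun ⟨x, hx⟩ => hx ▸ LinearMap.congr_fun coeffSum_comp_shiftSub x⟩
  have hs : ∀ (n : ℤ) (x : E),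
      Finsupp.single n x - Finsupp.single 0 x ∈ LinearMap.range (shiftSub K E) := by
    intro n x
    have step : ∀ n : ℤ, Finsupp.single (n + 1) x - Finsupp.single n x ∈
        LinearMap.range (shiftSub K E) := fun n => ⟨_, shiftSub_single n x⟩
    induction n with
    | zero => simp
    | succ n ih => simpa using Submodule.add_mem _ (step n) ih
    | pred n ih => simpa using Submodule.sub_mem _ ih (step (-n - 1))
  have key : ∀ y : ℤ →₀ E, y - Finsupp.single 0 (coeffSum K E y) ∈
      LinearMap.range (shiftSub K E) := by
    intro y
    induction y using Finsupp.induction_linear with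
    | zero => simp
    | add x y hx hy =>
      rw [map_add, Finsupp.single_add, add_sub_add_comm]
      exact Submodule.add_mem _ hx hy
    | single n x =>
      rw [coeffSum_single]
      exact hs n x
  simpa [hy] using key y

variable (S : SemilinearAut σ E) (T : SemilinearAut σ F)

/-- In the induced module the shift is `d ⊗ x ↦ d σ ⊗ Φ⁻¹ x`; right multiplication commutes with the
left action. -/
theorem SemilinearAut.shiftSub_Φ (x : ℤ →₀ E) :
    shiftSub K E (S.induced.Φ x) = S.induced.Φ (shiftSub K E x) := by
  induction x using Finsupp.induction_linear with
  | zero => simp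
  | add x y hx hy => simp only [map_add, hx, hy]
  | single n x => simp [S.induced_Φ_single, shiftSub_single]

theorem SemilinearAut.coeffSum_Φ (x : ℤ →₀ E) :
    coeffSum K E (S.induced.Φ x) = S.Φ (coeffSum K E x) := by
  induction x using Finsupp.induction_linear with
  | zero => simp
  | add x y hx hy => simp only [map_add, hx, hy]
  | single n x => simp [S.induced_Φ_single, coeffSum_single]

/-- The presentation of a module by induced modules. -/
abbrev SemilinearAut.presentation : ShortComplex (ModuleCat.{u} (OreRing σ)) :=
  ShortComplex.mk (hom (shiftSub K E) S.shiftSub_Φ) (hom (coeffSum K E) S.coeffSum_Φ)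
    (lin_injective coeffSum_comp_shiftSub)

theorem SemilinearAut.presentation_shortExact : S.presentation.ShortExact where
  exact := (ShortComplex.ShortExact.moduleCat_exact_iff_function_exact _).2
    (exact_shiftSub_coeffSum (K := K) (E := E))
  mono_f := (ModuleCat.mono_iff_injective _).2 (shiftSub_injective (K := K) (E := E))
  epi_g := (ModuleCat.epi_iff_surjective _).2 fun x =>
    ⟨Finsupp.single (M := E) 0 x, coeffSum_single (K := K) (E := E) 0 x⟩

/-- The morphism from the induced module given by a `K`-linear map. -/
def SemilinearAut.extendHom (f : E →ₗ[K] F) : S.induced.toModuleCat ⟶ T.toModuleCat :=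
  hom (S.extend T f) (S.extend_Φ T f)

/-- The uniqueness half of the adjunction between induction and restriction; identities of morphisms
can then be checked at index zero. -/
theorem SemilinearAut.hom_induced_ext {φ ψ : S.induced.toModuleCat ⟶ T.toModuleCat}
    (h : ∀ x : E, lin φ (Finsupp.single 0 x) = lin ψ (Finsupp.single 0 x)) : φ = ψ := by
  apply lin_injective
  rw [← S.extend_comp_lsingle T _ (lin_Φ φ), ← S.extend_comp_lsingle T _ (lin_Φ ψ)]
  congr 1
  exact LinearMap.ext h

theorem SemilinearAut.lin_extendHom_single (f : E →ₗ[K] F) (x : E) :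
    lin (S.extendHom T f) (Finsupp.single 0 x) = f x :=
  LinearMap.congr_fun (S.extend_comp_lsingle_zero T f) x

theorem SemilinearAut.extendHom_add (f g : E →ₗ[K] F) :
    S.extendHom T (f + g) = S.extendHom T f + S.extendHom T g :=
  S.hom_induced_ext T fun x => by
    rw [lin_extendHom_single, LinearMap.add_apply, ← S.lin_extendHom_single T f x,
      ← S.lin_extendHom_single T g x]
    rfl

open scoped ModuleCat.Algebra in
theorem SemilinearAut.extendHom_smul (c : C) (f : E →ₗ[K] F) :
    S.extendHom T (algebraMap C K c • f) = c • S.extendHom T f :=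
  S.hom_induced_ext T fun x => by
    refine (S.lin_extendHom_single T _ x).trans ?_
    have h : lin (c • S.extendHom T f) (Finsupp.single 0 x) =
        algebraMap C K c • lin (S.extendHom T f) (Finsupp.single 0 x) := by
      refine Eq.trans ?_ (T.oreC_smul (algebraMap C K c) _)
      rw [← algebraMap_oreRing]
      rfl
    rw [h, lin_extendHom_single]
    rfl

/-- Under the adjunction, the differential of the resolution becomes `f ↦ Φ f Φ⁻¹ - f`: at index
zero it gives `single 1 x - single 0 x`, and the extension of `f` at index one is the conjugate of
`f`. -/
theorem SemilinearAut.presentation_f_comp (f : E →ₗ[K] F) :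
    S.presentation.f ≫ S.extendHom T f = S.extendHom T (S.conj T f - f) :=
  S.hom_induced_ext T fun x => by
    refine Eq.trans ?_ (S.lin_extendHom_single T _ x).symm
    change S.extend T f (shiftSub K E (Finsupp.single 0 x)) = _
    rw [shiftSub_single, map_sub, extend_single, extend_single]
    rfl

end ExtComputation

/-! ### `Ext` as the cokernel of `f ↦ Φ f Φ⁻¹ - f` -/

section ExtBasis

variable {C K : Type u} [CommRing C] [CommRing K] [Algebra C K] {σ : K ≃ₐ[C] K}
  (M N : DiffModule σ)

open Abelian

/-- The class of the extension given by a `K`-linear map. -/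
def DiffModule.extMk (f : M →ₗ[K] N) : M.Ext N :=
  M.semilinearAut.presentation_shortExact.extClass.comp
    (Ext.mk₀ (M.semilinearAut.extendHom N.semilinearAut f)) (add_zero 1)

theorem DiffModule.extMk_add (f g : M →ₗ[K] N) :
    M.extMk N (f + g) = M.extMk N f + M.extMk N g := by
  rw [extMk, SemilinearAut.extendHom_add, Ext.mk₀_add]
  exact Ext.comp_add _ _ _ _

open scoped ModuleCat.Algebra in
theorem DiffModule.extMk_smul (c : C) (f : M →ₗ[K] N) :
    M.extMk N (algebraMap C K c • f) = c • M.extMk N f := by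
  rw [extMk, SemilinearAut.extendHom_smul, Ext.mk₀_smul]
  exact Ext.comp_smul _ _ _ _

/-- The middle term of the resolution is projective, so its `Ext¹` vanishes and the connecting map
is onto; morphisms out of the induced module come from `K`-linear maps. -/
theorem DiffModule.extMk_surjective : Function.Surjective (M.extMk N) := by
  intro x
  have : Projective M.semilinearAut.presentation.X₂ := M.semilinearAut.projective_induced
  obtain ⟨y, hy⟩ := Ext.contravariant_sequence_exact₃
    M.semilinearAut.presentation_shortExact N.semilinearAut.toModuleCat x (Ext.eq_zero_of_projective _)
    (add_zero 1)
  obtain ⟨φ, rfl⟩ := (Ext.mk₀_bijective _ _).2 y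
  refine ⟨SemilinearAut.lin (S := M.semilinearAut.induced) (T := N.semilinearAut) φ ∘ₗ
    Finsupp.lsingle 0, Eq.trans ?_ hy⟩
  have h : M.semilinearAut.extendHom N.semilinearAut
      (SemilinearAut.lin (S := M.semilinearAut.induced) (T := N.semilinearAut) φ ∘ₗ
        Finsupp.lsingle 0) = φ :=
    M.semilinearAut.hom_induced_ext N.semilinearAut
      fun x => M.semilinearAut.lin_extendHom_single N.semilinearAut _ x
  rw [extMk, h]

/-- By the long exact sequence, the class vanishes exactly when the morphism attached to `f` factors
through the differential of the resolution. -/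
theorem DiffModule.extMk_eq_zero_iff (f : M →ₗ[K] N) :
    M.extMk N f = 0 ↔ ∃ g, M.conj N g - g = f := by
  constructor
  · intro h
    obtain ⟨y, hy⟩ := Ext.contravariant_sequence_exact₁
      M.semilinearAut.presentation_shortExact N.semilinearAut.toModuleCat _ (add_zero 1) h
    obtain ⟨φ, rfl⟩ := (Ext.mk₀_bijective _ _).2 y
    let g : M →ₗ[K] N :=
      SemilinearAut.lin (S := M.semilinearAut.induced) (T := N.semilinearAut) φ ∘ₗ
        Finsupp.lsingle 0
    have hφ : M.semilinearAut.extendHom N.semilinearAut g = φ :=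
      M.semilinearAut.hom_induced_ext N.semilinearAut
        fun x => M.semilinearAut.lin_extendHom_single N.semilinearAut _ x
    refine ⟨g, ?_⟩
    have h1 := (Ext.mk₀_comp_mk₀ M.semilinearAut.presentation.f φ).symm.trans hy
    have h2 := (Ext.mk₀_bijective _ _).1 h1
    rw [← hφ, SemilinearAut.presentation_f_comp] at h2
    ext x
    have h3 := congrArg (fun ψ => SemilinearAut.lin (S := M.semilinearAut.induced)
      (T := N.semilinearAut) ψ (Finsupp.single 0 x)) h2
    simp only [SemilinearAut.lin_extendHom_single] at h3
    exact h3
  · rintro ⟨g, rfl⟩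
    have h := M.semilinearAut.presentation_f_comp N.semilinearAut g
    change M.semilinearAut.presentation_shortExact.extClass.comp
      (Ext.mk₀ (M.semilinearAut.extendHom N.semilinearAut
        (M.semilinearAut.conj N.semilinearAut g - g))) (add_zero 1) = 0
    rw [← h, ← Ext.mk₀_comp_mk₀]
    exact ShortComplex.ShortExact.extClass_comp_assoc _ _

variable {M N}

/-- If `Hom(M, N) = 0` and `Ext(M, N)` is free over `C`, then cocycles representing a basis of
`Ext(M, N)` span a complement of the (injectively parametrized) coboundaries. -/
theorem DiffModule.exists_cocycles (hHom : ∀ f : M.Hom N, f.toLin = 0) {n : ℕ}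
    (B : Module.Basis (Fin n) C (M.Ext N)) :
    ∃ b : Fin n → (M →ₗ[K] N),
      Function.Bijective fun cf : (Fin n → C) × (M →ₗ[K] N) =>
        ∑ a, algebraMap C K (cf.1 a) • b a + (M.conj N cf.2 - cf.2) := by
  choose b hb using fun a => M.extMk_surjective N (B a)
  let D : (M →ₗ[K] N) →+ M.Ext N := AddMonoidHom.mk' (M.extMk N) (M.extMk_add N)
  have hD : ∀ c : Fin n → C, D (∑ a, algebraMap C K (c a) • b a) = ∑ a, c a • B a := fun c => by
    rw [map_sum]
    refine Finset.sum_congr rfl fun a _ => ?_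
    rw [← hb]
    exact M.extMk_smul N _ _
  have hΔ : ∀ g, D (M.conj N g - g) = 0 := fun g => (M.extMk_eq_zero_iff N _).2 ⟨g, rfl⟩
  -- A map fixed by conjugation commutes with the semilinear automorphisms, so it is a morphism of
  -- difference modules.
  have hinj : ∀ g, M.conj N g - g = 0 → g = 0 := fun g hg => hHom ⟨g, fun x => by
    rw [← DiffModule.conj_apply_Φ, sub_eq_zero.1 hg]⟩
  refine ⟨b, fun ⟨c, f⟩ ⟨c', f'⟩ h => ?_, fun u => ?_⟩
  -- Passing to `Ext` kills the coboundaries and leaves the coordinates in the basis `B`.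
  · have h1 := congrArg D h
    simp only [map_add, hΔ, hD, add_zero] at h1
    have hc : c = c' := by
      have h2 := congrArg B.equivFun h1
      rwa [← B.equivFun_symm_apply, ← B.equivFun_symm_apply, LinearEquiv.apply_symm_apply,
        LinearEquiv.apply_symm_apply] at h2
    subst hc
    have h2 := add_left_cancel h
    have h3 := hinj (f - f') (by rw [map_sub, sub_sub_sub_comm, sub_eq_zero]; exact h2)
    rw [sub_eq_zero.1 h3]
  · have h1 : M.extMk N (u - ∑ a, algebraMap C K (B.equivFun (D u) a) • b a) = 0 := by
      change D _ = 0
      rw [map_sub, hD, B.sum_equivFun, sub_self]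
    obtain ⟨g, hg⟩ := (M.extMk_eq_zero_iff N _).1 h1
    exact ⟨(B.equivFun (D u), g), by simp [hg]⟩

end ExtBasis

/-! ### Base change of `Hom` and of cocycles -/

section HomBaseChange

-- The module is a retract of some `Rⁿ`, for which the claim is known. The comparison maps `L` and
-- `L₀` commute with precomposition by the two maps of the retraction, so bijectivity passes to the
-- retract.
open LinearMap in
theorem isBaseChange_baseChangeHom_of_projective (R S M N : Type*) [CommRing R] [CommRing S]
    [Algebra R S] [AddCommGroup M] [Module R M] [AddCommGroup N] [Module R N] [Module.Finite R M]
    [Module.Projective R M] : IsBaseChange S (baseChangeHom R S M N) := by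
  obtain ⟨n, f, g, -, -, hfg⟩ := Module.Finite.exists_comp_eq_id_of_projective R M
  have hn := Module.isBaseChange_map_of_finite_free N S (Fin n) (R := R)
  let L₀ := TensorProduct.lift
    (((Algebra.linearMap S (Module.End S (((Fin n → R) →ₗ[R] N) →ₗ[R] _))).flip
      (baseChangeHom R S (Fin n → R) N)).restrictScalars R)
  let L := TensorProduct.lift (((Algebra.linearMap S (Module.End S ((M →ₗ[R] N) →ₗ[R] _))).flip
    (baseChangeHom R S M N)).restrictScalars R)
  have hf : ∀ z, L₀ (((f.lcomp R N)).lTensor S z) = L z ∘ₗ f.baseChange S := by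
    intro z
    induction z with
    | zero => simp
    | tmul s h =>
      ext x
      simp [L₀, L]
    | add x y hx hy => simp only [map_add, hx, hy, add_comp]
  have hg : ∀ z, L (((g.lcomp R N)).lTensor S z) = L₀ z ∘ₗ g.baseChange S := by
    intro z
    induction z with
    | zero => simp
    | tmul s h =>
      ext x
      simp [L₀, L]
    | add x y hx hy => simp only [map_add, hx, hy, add_comp]
  have hid : (g.lcomp R N) ∘ₗ (f.lcomp R N) = LinearMap.id := by
    ext h x
    exact congrArg h (LinearMap.congr_fun hfg x)
  have hid' : f.baseChange S ∘ₗ g.baseChange S = LinearMap.id := by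
    rw [← baseChange_comp, hfg, baseChange_id]
  refine ⟨fun x y hxy => ?_, fun φ => ?_⟩
  · have h1 := hn.1 ((hf x).trans ((congrArg (· ∘ₗ f.baseChange S) hxy).trans (hf y).symm))
    have h2 := congrArg ((g.lcomp R N).lTensor S) h1
    rwa [← LinearMap.comp_apply, ← LinearMap.comp_apply, ← lTensor_comp, hid, lTensor_id] at h2
  · obtain ⟨z, hz⟩ := hn.2 (φ ∘ₗ f.baseChange S)
    refine ⟨(g.lcomp R N).lTensor S z, (hg z).trans ?_⟩
    change L₀ z = _ at hz
    rw [hz, comp_assoc, hid', comp_id]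

variable (C K C' : Type*) [CommRing C] [CommRing K] [Algebra C K] [CommRing C'] [Algebra C C']
  (M N : Type*) [AddCommGroup M] [Module K M] [AddCommGroup N] [Module K N] [Module C N]
  [IsScalarTower C K N]

/-- The comparison map for the `Hom` of two modules after extension of scalars. -/
theorem exists_homEquiv [Module.Finite K M] [Module.Projective K M] :
    ∃ θ : C' ⊗[C] (M →ₗ[K] N) ≃+ ((K ⊗[C] C') ⊗[K] M →ₗ[K ⊗[C] C'] (K ⊗[C] C') ⊗[K] N),
      ∀ c f, θ (c ⊗ₜ f) = ((1 : K) ⊗ₜ[C] c) • f.baseChange (K ⊗[C] C') := by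
  -- With `H = Hom_K(M, N)`: `C' ⊗[C] H ≃ H ⊗[C] C' ≃ H ⊗[K] (K ⊗[C] C') ≃ (K ⊗[C] C') ⊗[K] H`,
  -- followed by base change of `Hom`.
  let e₁ := (TensorProduct.comm C C' (M →ₗ[K] N)).toAddEquiv
  let e₂ : (M →ₗ[K] N) ⊗[C] C' ≃+ (M →ₗ[K] N) ⊗[K] (K ⊗[C] C') :=
    (AlgebraTensorModule.cancelBaseChange C K K (M →ₗ[K] N) C').symm.toAddEquiv
  let e₃ := (TensorProduct.comm K (M →ₗ[K] N) (K ⊗[C] C')).toAddEquiv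
  let e₄ := (isBaseChange_baseChangeHom_of_projective K (K ⊗[C] C') M N).equiv.toAddEquiv
  refine ⟨((e₁.trans e₂).trans e₃).trans e₄, fun c f => ?_⟩
  have h₂ : e₂ (f ⊗ₜ[C] c) = f ⊗ₜ[K] ((1 : K) ⊗ₜ[C] c) := by
    simp [e₂]
  change e₄ (e₃ (e₂ (f ⊗ₜ[C] c))) = _
  rw [h₂]
  exact (isBaseChange_baseChangeHom_of_projective K (K ⊗[C] C') M N).equiv_tmul _ _

end HomBaseChange

/-! ### Extension of scalars for the complement of the coboundaries -/

section CocycleBaseChange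

variable {C K : Type u} [CommRing C] [CommRing K] [Algebra C K] {σ : K ≃ₐ[C] K}

section

variable {L : Type u} [CommRing L] [Algebra C L] [Algebra K L] (τ : L ≃ₐ[C] L)
  (h : ∀ a : K, τ (algebraMap K L a) = algebraMap K L (σ a)) {M N : DiffModule σ}

/-- Extension of scalars of a `K`-linear map between difference modules. -/
def DiffModule.baseChangeMap (f : M →ₗ[K] N) : M.baseChange τ h →ₗ[L] N.baseChange τ h :=
  f.baseChange L

theorem DiffModule.conj_baseChangeMap (s : L) (f : M →ₗ[K] N) :
    (M.baseChange τ h).conj (N.baseChange τ h) (s • baseChangeMap τ h f) =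
      τ s • baseChangeMap τ h (M.conj N f) := by
  let F : L ⊗[K] M →ₗ[L] L ⊗[K] N :=
    (M.baseChange τ h).conj (N.baseChange τ h) (s • baseChangeMap τ h f)
  let G : L ⊗[K] M →ₗ[L] L ⊗[K] N := τ s • (M.conj N f).baseChange L
  suffices H : F.toAddMonoidHom = G.toAddMonoidHom from
    LinearMap.ext fun x => DFunLike.congr_fun H x
  refine tensor_addHom_ext fun l x => ?_
  change (τ (s • τ.symm l)) ⊗ₜ[K] N.Φ (f (M.Φ.symm x)) = (τ s • l) ⊗ₜ[K] _
  rw [smul_eq_mul, map_mul, AlgEquiv.apply_symm_apply]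
  rfl

end

variable {M N : DiffModule σ} (C' : Type u) [CommRing C'] [Algebra C C']

/-- Extension of scalars of a `K`-linear map to `K ⊗[C] C'`. -/
def DiffModule.extendMap (f : M →ₗ[K] N) :
    M.extendScalars C' →ₗ[K ⊗[C] C'] N.extendScalars C' :=
  f.baseChange (K ⊗[C] C')

/-- The scalars `1 ⊗ c` are fixed by `σ ⊗ 1`, so they pass through conjugation. -/
theorem DiffModule.conj_extendMap (c : C') (f : M →ₗ[K] N) :
    (M.extendScalars C').conj (N.extendScalars C') (((1 : K) ⊗ₜ[C] c) • extendMap C' f) =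
      ((1 : K) ⊗ₜ[C] c) • extendMap C' (M.conj N f) := by
  refine (DiffModule.conj_baseChangeMap _ _ _ f).trans ?_
  simp
  rfl

theorem DiffModule.extendMap_sum_smul {n : ℕ} (b : Fin n → (M →ₗ[K] N)) (c : C') (t : Fin n → C) :
    ((1 : K) ⊗ₜ[C] c) • extendMap C' (∑ a, algebraMap C K (t a) • b a) =
      ∑ a, ((1 : K) ⊗ₜ[C] (t a • c)) • extendMap C' (b a) := by
  have h : extendMap C' (∑ a, algebraMap C K (t a) • b a) =
      ∑ a, (algebraMap C K (t a) ⊗ₜ[C] (1 : C')) • extendMap C' (b a) := by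
    refine (map_sum (LinearMap.baseChangeHom K (K ⊗[C] C') M N) _ _).trans
      (Finset.sum_congr rfl fun a _ => ?_)
    refine (map_smul (LinearMap.baseChangeHom K (K ⊗[C] C') M N) _ _).trans ?_
    exact (algebraMap_smul (K ⊗[C] C') (algebraMap C K (t a)) _).symm
  rw [h, Finset.smul_sum]
  refine Finset.sum_congr rfl fun a _ => ?_
  rw [smul_smul, Algebra.TensorProduct.tmul_mul_tmul, one_mul, mul_one,
    Algebra.algebraMap_eq_smul_one, smul_tmul]

/-- A complement of the coboundaries remains one after extension of scalars. -/
theorem DiffModule.bijective_cocycles_extendScalars {n : ℕ} (b : Fin n → (M →ₗ[K] N))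
    (hb : Function.Bijective fun cf : (Fin n → C) × (M →ₗ[K] N) =>
      ∑ a, algebraMap C K (cf.1 a) • b a + (M.conj N cf.2 - cf.2)) :
    Function.Bijective
      fun cf : (Fin n → C') × (M.extendScalars C' →ₗ[K ⊗[C] C'] N.extendScalars C') =>
        ∑ a, ((1 : K) ⊗ₜ[C] cf.1 a) • extendMap C' (b a) +
          ((M.extendScalars C').conj (N.extendScalars C') cf.2 - cf.2) := by
  let _ : Module C N := Module.compHom N (algebraMap C K)
  have : IsScalarTower C K N := ⟨fun c a x => by
    rw [Algebra.smul_def, mul_smul]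
    rfl⟩
  have hsmul : ∀ (c : C) (f : M →ₗ[K] N), c • f = algebraMap C K c • f := fun c f => rfl
  -- Linearity over `C`, due to `σ` fixing `C`, is what permits tensoring the bijection with `C'`.
  let Ψ : ((Fin n → C) × (M →ₗ[K] N)) →ₗ[C] (M →ₗ[K] N) :=
    { toFun := fun cf => ∑ a, algebraMap C K (cf.1 a) • b a + (M.conj N cf.2 - cf.2)
      map_add' := fun x y => by
        simp only [Prod.fst_add, Prod.snd_add, Pi.add_apply, map_add, add_smul,
          Finset.sum_add_distrib]
        abel
      map_smul' := fun c x => by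
        have h : M.conj N (c • x.2) = c • M.conj N x.2 := by
          ext m
          rw [hsmul, hsmul, DiffModule.conj_apply, LinearMap.smul_apply, N.Φ_smul, σ.commutes]
          rfl
        simp only [Prod.smul_fst, Prod.smul_snd, Pi.smul_apply, h, smul_eq_mul, map_mul,
          RingHom.id_apply, smul_add, smul_sub, Finset.smul_sum, mul_smul, ← hsmul] }
  let Ψe := LinearEquiv.ofBijective Ψ hb
  obtain ⟨θ, hθ⟩ : ∃ θ : C' ⊗[C] (M →ₗ[K] N) ≃+
        (M.extendScalars C' →ₗ[K ⊗[C] C'] N.extendScalars C'),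
      ∀ c f, θ (c ⊗ₜ f) = ((1 : K) ⊗ₜ[C] c) • extendMap C' f :=
    exists_homEquiv C K C' M N
  let e := (TensorProduct.prodRight C C C' (Fin n → C) (M →ₗ[K] N)).toAddEquiv.trans
    (AddEquiv.prodCongr (TensorProduct.piScalarRight C C C' (Fin n)).toAddEquiv θ)
  let G : (Fin n → C') × (M.extendScalars C' →ₗ[K ⊗[C] C'] N.extendScalars C') →+
      (M.extendScalars C' →ₗ[K ⊗[C] C'] N.extendScalars C') :=
    AddMonoidHom.mk' (fun cf => ∑ a, ((1 : K) ⊗ₜ[C] cf.1 a) • extendMap C' (b a) +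
      ((M.extendScalars C').conj (N.extendScalars C') cf.2 - cf.2)) fun x y => by
        simp only [Prod.fst_add, Prod.snd_add, Pi.add_apply, map_add, tmul_add, add_smul,
          Finset.sum_add_distrib]
        abel
  -- Up to the identifications `e` and `θ`, the map over `C'` is `1 ⊗ Ψ`, an isomorphism because `Ψ`
  -- is one.
  have key : ∀ z, G (e z) = θ (Ψe.lTensor C' z) := by
    intro z
    induction z with
    | zero => simp only [map_zero]
    | add x y hx hy => simp only [map_add, hx, hy]
    | tmul c tf =>
      obtain ⟨t, f⟩ := tf
      have h1 : e (c ⊗ₜ (t, f)) = (fun a => t a • c, ((1 : K) ⊗ₜ[C] c) • extendMap C' f) :=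
        
        Prod.ext (piScalarRightHom_tmul C C C' (Fin n) c t) (hθ c f)
      have h2 : Ψe.lTensor C' (c ⊗ₜ (t, f)) = c ⊗ₜ Ψ (t, f) := rfl
      rw [h1, h2, hθ]
      change ∑ a, ((1 : K) ⊗ₜ[C] (t a • c)) • extendMap C' (b a) + _ = ((1 : K) ⊗ₜ[C] c) •
        (LinearMap.baseChangeHom K (K ⊗[C] C') M N)
          (∑ a, algebraMap C K (t a) • b a + (M.conj N f - f))
      rw [map_add, map_sub, smul_add, smul_sub]
      rw [← DiffModule.extendMap_sum_smul, DiffModule.conj_extendMap]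
      rfl
  have h : (G : _ → _) = θ ∘ Ψe.lTensor C' ∘ e.symm := by
    funext z
    rw [Function.comp_apply, Function.comp_apply, ← key, AddEquiv.apply_symm_apply]
  change Function.Bijective G
  rw [h]
  exact θ.bijective.comp ((Ψe.lTensor C').bijective.comp e.symm.bijective)

end CocycleBaseChange

/-! ### Extension of scalars of the modules given by unipotent matrices -/

section MatrixBaseChange

variable {C K L : Type u} [CommRing C] [CommRing K] [Algebra C K] [CommRing L] [Algebra C L]
  [Algebra K L] {σ : K ≃ₐ[C] K} {τ : L ≃ₐ[C] L} {k : ℕ}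

/-- The comparison map from the extension of scalars of a direct sum to the direct sum of modules
`R i` receiving maps from the extensions of scalars of the summands. -/
def prodLift {Q : Fin k → DiffModule σ} {R : Fin k → DiffModule τ}
    (c : ∀ i, L ⊗[K] Q i →ₗ[L] R i) : L ⊗[K] (∀ i, Q i) →ₗ[L] ∀ i, R i :=
  LinearMap.pi fun i => c i ∘ₗ (LinearMap.proj (φ := fun i => Q i) i).baseChange L

/-- Extension of scalars of the filtered module given by a unipotent matrix. -/
theorem FilteredModule.mapGr_baseChange_ofMatrix {Q : Fin k → DiffModule σ}
    {R : Fin k → DiffModule τ} (h : ∀ a : K, τ (algebraMap K L a) = algebraMap K L (σ a))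
    (e : ∀ i, (Q i).baseChange τ h ≃ₗ[L] R i)
    (he : ∀ i x, e i (((Q i).baseChange τ h).Φ x) = (R i).Φ (e i x))
    (c : ∀ i, L ⊗[K] Q i →ₗ[L] R i) (hc : ∀ i, c i = (e i).toLinearMap)
    (g₁ : UpperFamily Q) (g₂ : UpperFamily R)
    (hg : ∀ (p : UpperPair k) (l : L) (y : Q p.1.2),
      c p.1.1 (l ⊗ₜ g₁ p y) = g₂ p (c p.1.2 (l ⊗ₜ y))) :
    (((ofMatrix g₁).baseChange τ h).mapGr e he).Equivalent (ofMatrix g₂) := by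
  have hcΦ : ∀ i l (x : Q i), c i (τ l ⊗ₜ (Q i).Φ x) = (R i).Φ (c i (l ⊗ₜ x)) := fun i l x => by
    rw [hc]
    exact he i (l ⊗ₜ[K] x)
  have hg' : ∀ (i j : Fin k) (l : L) (y : Q j),
      c i (l ⊗ₜ uni g₁ i j y) = uni g₂ i j (c j (l ⊗ₜ y)) := by
    intro i j l y
    rcases lt_trichotomy i j with h | rfl | h
    · rw [uni_of_lt _ h, uni_of_lt _ h]
      exact hg ⟨(i, j), h⟩ l y
    · rw [uni_self, uni_self]
      rfl
    · rw [uni_of_gt _ h, uni_of_gt _ h, LinearMap.zero_apply, tmul_zero, map_zero,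
        LinearMap.zero_apply]
  let f := prodLift c
  have hF : ∀ (m : Fin (k + 1)) (x : (stdFil Q m).baseChange L), f x.1 ∈ stdFil R m := by
    intro m
    refine baseChange_induction (L := L) (X := ofMatrix g₁) ?_ (fun l x => ?_)
      fun x y hx hy => ?_
    · exact (map_zero f).symm ▸ Submodule.zero_mem _
    · intro j hj
      refine (congrArg (fun z => c j (l ⊗ₜ[K] z)) (x.2 j hj)).trans ?_
      simp
    · exact (map_add f x.1 y.1).symm ▸ Submodule.add_mem _ hx hy
  refine ⟨⟨f, fun x => ?_⟩, fun m x hx => hF m ⟨x, hx⟩, fun i x => ?_⟩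
  · let F : L ⊗[K] (∀ i, Q i) →+ ∀ i, R i :=
      f.toAddMonoidHom.comp ((twistedModule g₁).baseChange τ h).Φ.toAddMonoidHom
    let G : L ⊗[K] (∀ i, Q i) →+ ∀ i, R i :=
      (twistedModule g₂).Φ.toAddMonoidHom.comp f.toAddMonoidHom
    suffices H : F = G from DFunLike.congr_fun H x
    refine tensor_addHom_ext fun l y => funext fun i => ?_
    change c i (τ l ⊗ₜ (matLin (uni g₁) (prodΦ _ y) i)) =
      matLin (uni g₂) (prodΦ _ (f (l ⊗ₜ y))) i
    rw [matLin_apply, matLin_apply, tmul_sum, map_sum]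
    exact Finset.sum_congr rfl fun j _ => (hg' i j _ _).trans (congrArg (uni g₂ i j) (hcΦ j l _))
  · revert x
    refine baseChange_induction (L := L) (X := ofMatrix g₁) ?_ (fun l x => ?_)
      fun x y hx hy => ?_
    · exact (congrFun (map_zero f) i).trans
        (map_zero ((((ofMatrix g₁).baseChange τ h).mapGr e he).v i)).symm
    · refine (LinearMap.congr_fun (hc i) (l ⊗ₜ[K] (x.1 : ∀ i, Q i) i)).trans ?_
      exact (congrArg (e i) ((ofMatrix g₁).vBaseChange_tmul L i l x _)).symm
    · exact (congrFun (map_add f x.1 y.1) i).trans ((congrArg₂ (· + ·) hx hy).trans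
        (map_add ((((ofMatrix g₁).baseChange τ h).mapGr e he).v i) _ _).symm)

end MatrixBaseChange

/-- Extension of scalars commutes with finite direct sums, so it suffices that the entries
correspond under `K₂ ⊗ (K₁ ⊗ P i) ≃ K₂ ⊗ P i`. -/
theorem FilteredModule.extend_ofMatrix {C K K₁ K₂ : Type u} [CommRing C] [CommRing K] [Algebra C K]
    [CommRing K₁] [Algebra C K₁] [CommRing K₂] [Algebra C K₂] [Algebra K K₁] [Algebra K K₂]
    [Algebra K₁ K₂] [IsScalarTower K K₁ K₂] {σ : K ≃ₐ[C] K} {k : ℕ} {P : Fin k → DiffModule σ}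
    {σ₁ : K₁ ≃ₐ[C] K₁} {σ₂ : K₂ ≃ₐ[C] K₂}
    {h₁ : ∀ a : K, σ₁ (algebraMap K K₁ a) = algebraMap K K₁ (σ a)}
    (h₂ : ∀ a : K, σ₂ (algebraMap K K₂ a) = algebraMap K K₂ (σ a))
    (h₁₂ : ∀ a : K₁, σ₂ (algebraMap K₁ K₂ a) = algebraMap K₁ K₂ (σ₁ a))
    (g₁ : UpperFamily fun i => (P i).baseChange σ₁ h₁)
    (g₂ : UpperFamily fun i => (P i).baseChange σ₂ h₂)
    (hg : ∀ (p : UpperPair k) (l : K₂) (y : K₁ ⊗[K] P p.1.2),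
      AlgebraTensorModule.cancelBaseChange K K₁ K₂ K₂ (P p.1.1) (l ⊗ₜ g₁ p y) =
        g₂ p (AlgebraTensorModule.cancelBaseChange K K₁ K₂ K₂ (P p.1.2) (l ⊗ₜ y))) :
    ((ofMatrix g₁).extend h₂ h₁₂).Equivalent (ofMatrix g₂) :=
  mapGr_baseChange_ofMatrix (Q := fun i => (P i).baseChange σ₁ h₁)
    (R := fun i => (P i).baseChange σ₂ h₂) h₁₂
    (fun i => AlgebraTensorModule.cancelBaseChange K K₁ K₂ K₂ (P i))
    (fun i x => (P i).cancelBaseChange_Φ h₂ h₁₂ x)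
    (fun i => (AlgebraTensorModule.cancelBaseChange K K₁ K₂ K₂ (P i)).toLinearMap)
    (fun _ => rfl) g₁ g₂ hg

/-- Supplies the entrywise hypothesis of `extend_ofMatrix`: as the `b a` live over `K`, only the
coefficients move from `K₁` to `K₂`. -/
theorem cancelBaseChange_sum_smul_baseChange {K K₁ K₂ E F : Type*} [CommRing K] [CommRing K₁]
    [CommRing K₂] [Algebra K K₁] [Algebra K K₂] [Algebra K₁ K₂] [IsScalarTower K K₁ K₂]
    [AddCommGroup E] [Module K E] [AddCommGroup F] [Module K F] {n : ℕ} (b : Fin n → (E →ₗ[K] F))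
    (s : Fin n → K₁) (l : K₂) (y : K₁ ⊗[K] E) :
    AlgebraTensorModule.cancelBaseChange K K₁ K₂ K₂ F
        (l ⊗ₜ (∑ a, s a • (b a).baseChange K₁) y) =
      (∑ a, algebraMap K₁ K₂ (s a) • (b a).baseChange K₂)
        (AlgebraTensorModule.cancelBaseChange K K₁ K₂ K₂ E (l ⊗ₜ y)) := by
  rw [LinearMap.sum_apply, LinearMap.sum_apply, tmul_sum, map_sum]
  refine Finset.sum_congr rfl fun a _ => ?_
  rw [LinearMap.smul_apply, LinearMap.smul_apply]
  induction y with
  | zero => simp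
  | tmul x z => simp [smul_tmul', Algebra.smul_def, mul_assoc]
  | add x y hx hy => simp only [map_add, smul_add, tmul_add, hx, hy]

/-! ### Coordinates on the classes and their naturality -/

section Represent

variable {C K : Type u} [CommRing C] [CommRing K] [Algebra C K] {σ : K ≃ₐ[C] K} {k : ℕ}
  (P : Fin k → DiffModule σ) {δ : UpperPair k → ℕ}
  (b : ∀ p : UpperPair k, Fin (δ p) → (P p.1.2 →ₗ[K] P p.1.1))

/-- The `C'`-linear combinations of given maps `P j → P i`, after extension of scalars. -/
def combination (C' : Type u) [CommRing C'] [Algebra C C'] (p : UpperPair k) (s : Fin (δ p) → C') :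
    (P p.1.2).extendScalars C' →ₗ[K ⊗[C] C'] (P p.1.1).extendScalars C' :=
  ∑ a, ((1 : K) ⊗ₜ[C] s a) • DiffModule.extendMap C' (b p a)

/-- The class of the filtered module given by the unipotent matrix of linear combinations. -/
def classOf (C' : Type u) [CommRing C'] [Algebra C C'] (s : ∀ p : UpperPair k, Fin (δ p) → C') :
    FilteredClasses fun i => (P i).extendScalars C' :=
  Quot.mk _ (FilteredModule.ofMatrix fun p => combination P b C' p (s p))

theorem extend_classOf {C' C'' : Type u} [CommRing C'] [Algebra C C'] [CommRing C'']
    [Algebra C C''] (φ : C' →ₐ[C] C'') (s : ∀ p : UpperPair k, Fin (δ p) → C') :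
    FilteredClasses.extend P φ (classOf P b C' s) = classOf P b C'' fun p a => φ (s p a) := by
  let F : K ⊗[C] C' →ₐ[K] K ⊗[C] C'' := Algebra.TensorProduct.map (AlgHom.id K K) φ
  let _ : Algebra (K ⊗[C] C') (K ⊗[C] C'') := F.toRingHom.toAlgebra
  have : IsScalarTower K (K ⊗[C] C') (K ⊗[C] C'') :=
    IsScalarTower.of_algebraMap_eq fun a => (F.commutes a).symm
  refine Quot.sound (FilteredModule.extend_ofMatrix (P := P) (σ₁ := extendAut σ C')
    (σ₂ := extendAut σ C'') _ (extendAut_map σ φ) (fun p => combination P b C' p (s p))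
    (fun p => combination P b C'' p fun a => φ (s p a)) fun p l y => ?_)
  exact cancelBaseChange_sum_smul_baseChange (b p) (fun a => (1 : K) ⊗ₜ[C] s p a) l y

/-- The normal form is applied over `K ⊗[C] C'`; its hypothesis there comes from the one over `K` by
extension of scalars. -/
theorem bijective_classOf
    (hb : ∀ p : UpperPair k, Function.Bijective
      fun cf : (Fin (δ p) → C) × (P p.1.2 →ₗ[K] P p.1.1) =>
        ∑ a, algebraMap C K (cf.1 a) • b p a + ((P p.1.2).conj (P p.1.1) cf.2 - cf.2))
    (C' : Type u) [CommRing C'] [Algebra C C'] : Function.Bijective (classOf P b C') :=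
  bijective_mk_ofMatrix (P := fun i => (P i).extendScalars C') (S := fun p => Fin (δ p) → C')
    (combination P b C') fun p => DiffModule.bijective_cocycles_extendScalars C' (b p) (hb p)

theorem sum_upperPair (δ : Fin k → Fin k → ℕ) :
    ∑ p : UpperPair k, δ p.1.1 p.1.2 = ∑ i : Fin k, ∑ j ∈ Finset.Ioi i, δ i j := by
  rw [Finset.sum_sigma' Finset.univ (fun i : Fin k => Finset.Ioi i) fun i j => δ i j]
  refine Finset.sum_bij' (fun p _ => ⟨p.1.1, p.1.2⟩)
    (fun q hq => ⟨(q.1, q.2), by simpa using hq⟩) ?_ ?_ ?_ ?_ ?_ <;> simp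

end Represent

end DifferenceModules

end

theorem mainTheorem1 {C K : Type u} [CommRing C] [CommRing K] [Algebra C K] (σ : K ≃ₐ[C] K)
    (k : ℕ) (P : Fin k → DifferenceModules.DiffModule σ) (δ : Fin k → Fin k → ℕ)
    (hHom : ∀ i j : Fin k, i < j → ∀ f : (P j).Hom (P i), f.toLin = 0)
    (hExt : ∀ i j : Fin k, i < j →
      Nonempty (Module.Basis (Fin (δ i j)) C ((P j).Ext (P i)))) :
    Nonempty ((DifferenceModules.moduliFunctor P).CorepresentableBy
      (CommAlgCat.of C (MvPolynomial (Fin (∑ i : Fin k, ∑ j ∈ Finset.Ioi i, δ i j)) C))) := by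
  choose b hb using fun p : DifferenceModules.UpperPair k =>
    DifferenceModules.DiffModule.exists_cocycles (hHom p.1.1 p.1.2 p.2) (hExt _ _ p.2).some
  -- One variable for each basis element of each `Ext(P j, P i)`, `i < j`.
  let e : (Σ p : DifferenceModules.UpperPair k, Fin (δ p.1.1 p.1.2)) ≃
      Fin (∑ i : Fin k, ∑ j ∈ Finset.Ioi i, δ i j) :=
    Fintype.equivFinOfCardEq (by simp [DifferenceModules.sum_upperPair δ])
  let E : ∀ C' : CommAlgCat.{u} C,
      (CommAlgCat.of C (MvPolynomial (Fin (∑ i : Fin k, ∑ j ∈ Finset.Ioi i, δ i j)) C) ⟶ C') ≃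
        ∀ p : DifferenceModules.UpperPair k, Fin (δ p.1.1 p.1.2) → C' := fun C' =>
    { toFun := fun f p a => f.hom (MvPolynomial.X (e ⟨p, a⟩))
      invFun := fun s => CommAlgCat.ofHom
        (MvPolynomial.aeval fun n => s (e.symm n).1 (e.symm n).2)
      left_inv := fun f => by
        ext n
        simp
      right_inv := fun s => by
        funext p a
        simpa using congrArg (fun q : Σ p : DifferenceModules.UpperPair k, Fin (δ p.1.1 p.1.2) =>
          s q.1 q.2) (e.symm_apply_apply ⟨p, a⟩) }
  exact ⟨
    { homEquiv := fun {C'} => (E C').trans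
        (Equiv.ofBijective _ (DifferenceModules.bijective_classOf P b hb C'))
      -- Naturality: composing with `g` applies `g` to the coordinates, as extension of scalars
      -- does.
      homEquiv_comp := fun g f =>
        (DifferenceModules.extend_classOf P b g.hom (E _ f)).symm }⟩
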